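/- Let $\mathbb{K}\in\{\mathbb{R},\mathbb{C}\}$ and let $X$ be a compact Hausdorff space. A Banach bundle over $X$ is a locally trivial bundle of $\mathbb{K}$-Banach spaces with a fixed model space and norm-continuous transition functions; a morphism of Banach bundles is a fibrewise bounded linear bundle map which is norm-continuous in local trivializations. A morphism $L:\mathcal{E}\to\mathcal{F}$ is a Fredholm morphism if, for some $k\in\mathbb{Z}$, each $L_\lambda:\mathcal{E}_\lambda\to\mathcal{F}_\lambda$ ($\lambda\in X$) is a bounded Fredholm operator of index $k$. Let $K(X)$ be the Grothendieck group of finite dimensional $\mathbb{K}$-vector bundles (of locally constant rank) over $X$ under direct sum (so $KO(X)$ is meant if $\mathbb{K}=\mathbb{R}$). For a Fredholm morphism $L:\mathcal{E}\to\mathcal{F}$, a finite dimensional subbundle $\mathcal{V}\subset\mathcal{F}$ is called transversal to $\operatorname{im}L$ if $\operatorname{im}(L_\lambda)+\mathcal{V}_\lambda=\mathcal{F}_\lambda$ for all $\lambda\in X$. The index bundle of $L$ is $$\operatorname{ind}(L)=[E(L,\mathcal{V})]-[\mathcal{V}]\in K(X),\qquad E(L,\mathcal{V})_\lambda=\{u\in\mathcal{E}_\lambda: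 L_\lambda u\in\mathcal{V}_\lambda\},$$ where $\mathcal{V}$ is any finite dimensional subbundle of $\mathcal{F}$ transversal to $\operatorname{im}L$; it is well defined, that is, such $\mathcal{V}$ exist, each $E(L,\mathcal{V})$ is a finite dimensional subbundle of $\mathcal{E}$, and $[E(L,\mathcal{V})]-[\mathcal{V}]$ does not depend on $\mathcal{V}$. Lemma (Direct sum property). Let $L:\mathcal{E}\to\mathcal{F}$ and $M:\tilde{\mathcal{E}}\to\tilde{\mathcal{F}}$ be Fredholm morphisms between Banach bundles over $X$. Then $L\oplus M:\mathcal{E}\oplus\tilde{\mathcal{E}}\to\mathcal{F}\oplus\tilde{\mathcal{F}}$ is a Fredholm morphism, the index bundles of $L$, $M$ and $L\oplus M$ are well defined in the above sense, and $$\operatorname{ind}(L\oplus M)=\operatorname{ind}(L)+\operatorname{ind}(M)\in K(X).$$ -/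

import Mathlib

open Bundle

universe u v

noncomputable section

namespace IndexBundle

/-! ### Finite dimensional vector bundles and topological `K`-theory -/

/-- A family of vector spaces `E x`, `x ∈ X`, with a topology on its total space, is a finite
dimensional vector bundle if it is locally trivial: every point of `X` lies in the (open) base set
of a fibrewise linear local trivialization with some model fibre `𝕜ⁿ`. The rank `n` is only locally
constant. (The first argument of `TotalSpace` is a phantom parameter.) -/
def IsFiniteDimBundle (𝕜 : Type*) [RCLike 𝕜] {X : Type u} [TopologicalSpace X] (E : X → Type v)
    [∀ x, AddCommGroup (E x)] [∀ x, Module 𝕜 (E x)] [TopologicalSpace (TotalSpace Unit E)] :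
    Prop :=
  ∀ x : X, ∃ (n : ℕ) (e : Trivialization (Fin n → 𝕜) (π Unit E)),
    x ∈ e.baseSet ∧ ∀ y ∈ e.baseSet, IsLinearMap 𝕜 fun w : E y => (e ⟨y, w⟩).2

/-- Finite dimensional `𝕜`-vector bundles over `X`. -/
structure FiniteDimBundle (𝕜 : Type*) [RCLike 𝕜] (X : Type u) [TopologicalSpace X] where
  /-- the fibres -/
  Fiber : X → Type v
  [addCommGroup : ∀ x, AddCommGroup (Fiber x)]
  [module : ∀ x, Module 𝕜 (Fiber x)]
  [topology : TopologicalSpace (TotalSpace Unit Fiber)]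
  isFiniteDimBundle : IsFiniteDimBundle 𝕜 Fiber

attribute [instance] FiniteDimBundle.addCommGroup FiniteDimBundle.module FiniteDimBundle.topology

/-- `A ≅ B ⊕ C`: there are linear isomorphisms `A x ≃ B x × C x` which together form a
homeomorphism of the total space of `A` onto the fibre product over `X` of the total spaces of `B`
and `C` (with the topology induced from their product). -/
def IsDirectSum {𝕜 : Type*} [RCLike 𝕜] {X : Type u} [TopologicalSpace X]
    (A B C : FiniteDimBundle.{u, v} 𝕜 X) : Prop :=
  ∃ φ : ∀ x, A.Fiber x ≃ₗ[𝕜] B.Fiber x × C.Fiber x,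
    Topology.IsInducing fun p : TotalSpace Unit A.Fiber =>
      ((⟨p.1, (φ p.1 p.2).1⟩, ⟨p.1, (φ p.1 p.2).2⟩) :
        TotalSpace Unit B.Fiber × TotalSpace Unit C.Fiber)

/-- The group `K(X)` (that is, `KO(X)` if `𝕜 = ℝ`): the free abelian group on the finite
dimensional vector bundles over `X`, modulo the relations `[A] = [B] + [C]` for `A ≅ B ⊕ C`. -/
abbrev KGroup (𝕜 : Type*) [RCLike 𝕜] (X : Type u) [TopologicalSpace X] :=
  FreeAbelianGroup (FiniteDimBundle.{u, v} 𝕜 X) ⧸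
    AddSubgroup.closure {r : FreeAbelianGroup (FiniteDimBundle.{u, v} 𝕜 X) |
      ∃ A B C : FiniteDimBundle.{u, v} 𝕜 X, IsDirectSum A B C ∧
        r = FreeAbelianGroup.of A - (FreeAbelianGroup.of B + FreeAbelianGroup.of C)}

/-- The class `[A] ∈ K(X)` of a finite dimensional vector bundle. -/
def FiniteDimBundle.toK {𝕜 : Type*} [RCLike 𝕜] {X : Type u} [TopologicalSpace X]
    (A : FiniteDimBundle.{u, v} 𝕜 X) : KGroup.{u, v} 𝕜 X :=
  QuotientAddGroup.mk (FreeAbelianGroup.of A)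

/-! ### Finite dimensional subbundles of Banach bundles -/

section Subbundle

variable (𝕜 : Type*) [RCLike 𝕜] {X : Type u} [TopologicalSpace X]
  (F₀ : Type*) (F : X → Type v) [∀ x, AddCommGroup (F x)] [∀ x, Module 𝕜 (F x)]
  [TopologicalSpace (TotalSpace F₀ F)]

/-- The total space of a family of subspaces of the fibres of `F` carries the subspace topology. -/
abbrev subspaceTopology (V : ∀ x, Submodule 𝕜 (F x)) :
    TopologicalSpace (TotalSpace Unit fun x => V x) :=
  TopologicalSpace.induced (fun p => (⟨p.1, (p.2 : F p.1)⟩ : TotalSpace F₀ F)) inferInstance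

/-- A finite dimensional subbundle of a bundle `F` (with model space `F₀`): a family of subspaces
of the fibres which is a finite dimensional vector bundle in the subspace topology. -/
structure FiniteDimSubbundle where
  /-- the fibres -/
  space : ∀ x, Submodule 𝕜 (F x)
  isFiniteDimBundle :
    letI := subspaceTopology 𝕜 F₀ F space
    IsFiniteDimBundle 𝕜 fun x => space x

variable {𝕜 F₀ F}

/-- A finite dimensional subbundle, considered as a vector bundle in its own right. -/
def FiniteDimSubbundle.toBundle (V : FiniteDimSubbundle 𝕜 F₀ F) : FiniteDimBundle.{u, v} 𝕜 X :=
  letI := subspaceTopology 𝕜 F₀ F V.space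
  { Fiber := fun x => V.space x
    isFiniteDimBundle := V.isFiniteDimBundle }

end Subbundle

/-! ### Fredholm morphisms and their index bundles -/

section Fredholm

/-- The index `dim ker T - dim coker T` of a Fredholm operator. -/
def fredholmIndex {𝕜 : Type*} [RCLike 𝕜] {V W : Type*} [AddCommGroup V] [Module 𝕜 V]
    [TopologicalSpace V] [AddCommGroup W] [Module 𝕜 W] [TopologicalSpace W] (T : V →L[𝕜] W) : ℤ :=
  (Module.finrank 𝕜 T.ker : ℤ) - (Module.finrank 𝕜 (W ⧸ T.range) : ℤ)

variable {𝕜 : Type*} [RCLike 𝕜] {X : Type u} [TopologicalSpace X]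
  (E₀ F₀ : Type*) [NormedAddCommGroup E₀] [NormedSpace 𝕜 E₀]
  [NormedAddCommGroup F₀] [NormedSpace 𝕜 F₀]
  {E F : X → Type v}
  [∀ x, AddCommGroup (E x)] [∀ x, Module 𝕜 (E x)] [∀ x, TopologicalSpace (E x)]
  [TopologicalSpace (TotalSpace E₀ E)] [FiberBundle E₀ E] [VectorBundle 𝕜 E₀ E]
  [∀ x, AddCommGroup (F x)] [∀ x, Module 𝕜 (F x)] [∀ x, TopologicalSpace (F x)]
  [∀ x, IsTopologicalAddGroup (F x)] [∀ x, ContinuousSMul 𝕜 (F x)]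
  [TopologicalSpace (TotalSpace F₀ F)] [FiberBundle F₀ F] [VectorBundle 𝕜 F₀ F]

/-- A family of continuous linear maps `L x : E x → F x` is a morphism of Banach bundles if it is
continuous for the operator norm in local trivializations, i.e. if it is a continuous section of
the bundle of continuous linear maps from `E` to `F`. -/
def IsMorphism (L : ∀ x, E x →L[𝕜] F x) : Prop :=
  Continuous fun x =>
    TotalSpace.mk' (E₀ →L[𝕜] F₀) (E := fun x => E x →L[𝕜] F x) x (L x)

/-- A Fredholm morphism: a morphism which, for some integer `k`, is a Fredholm operator of index `k`
in every fibre. -/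
def IsFredholmMorphism (L : ∀ x, E x →L[𝕜] F x) : Prop :=
  IsMorphism E₀ F₀ L ∧ ∃ k : ℤ, ∀ x, (L x).IsFredholm ∧ fredholmIndex (L x) = k

/-- `V` is transversal to the image of `L`: `im (L x) + V x = F x` for all `x`. -/
def IsTransversal (L : ∀ x, E x →L[𝕜] F x) (V : FiniteDimSubbundle 𝕜 F₀ F) : Prop :=
  ∀ x, (L x).range ⊔ V.space x = ⊤

/-- `κ` is the index bundle of `L`: finite dimensional subbundles `V` of `F` which are transversal
to the image of `L` exist, and, for every such `V`, the spaces
`E(L, V) x = {w ∈ E x | L x w ∈ V x}` form a finite dimensional subbundle of `E` and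
`κ = [E(L, V)] - [V]`. -/
def IsIndexBundle (L : ∀ x, E x →L[𝕜] F x) (κ : KGroup.{u, v} 𝕜 X) : Prop :=
  (∃ V : FiniteDimSubbundle 𝕜 F₀ F, IsTransversal F₀ L V) ∧
    ∀ V : FiniteDimSubbundle 𝕜 F₀ F, IsTransversal F₀ L V →
      ∃ W : FiniteDimSubbundle 𝕜 E₀ E,
        (∀ x, W.space x = (V.space x).comap (L x : E x →ₗ[𝕜] F x)) ∧
          κ = W.toBundle.toK - V.toBundle.toK

open scoped Classical in
/-- The index bundle `ind L ∈ K(X)` of `L` (with value `0` if `L` has no index bundle). -/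
def ind (L : ∀ x, E x →L[𝕜] F x) : KGroup.{u, v} 𝕜 X :=
  if h : ∃ κ, IsIndexBundle E₀ F₀ L κ then h.choose else 0

end Fredholm

end IndexBundle

end

open IndexBundle

noncomputable section

namespace IndexBundle

open Topology Set Filter

/-! ### Functional analysis -/

section Inverse

variable {R : Type*} [NormedRing R] [HasSummableGeomSeries R] {Y : Type*} [TopologicalSpace Y]

/-! The formula itself is formal. If `V` and `V'` are transversal to `L` and `M`, then `V ⊕ V'` is
transversal to `L ⊕ M`, and the preimage of `V ⊕ V'` under `L ⊕ M` is `E(L, V) ⊕ E(M, V')`;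
computing all three index bundles with these choices gives the sum (`IsIndexBundle.add`). The work
lies in well-definedness, which has three ingredients.

Existence (`exists_isTransversal`). By compactness, finitely many sections span a complement of the
image of `L` in every fibre, but they may be linearly dependent. If the model space of `F` is finite
dimensional, `V = F` serves. Otherwise the sections are put in general position: an infinite
dimensional Banach space is not σ-compact, so there are constants independent modulo the span of all
values of the sections on a compact set. Adding a small multiple of them makes the sections
independent there without losing transversality.

Subbundle property (`exists_finiteDimSubbundle_comap`). In local trivializations, with a frame `s`
of `V`, the operator `Φ x (u, c) = L x u + s x c` is onto with finite dimensional kernel. A right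
inverse at one point yields right inverses nearby, hence continuous projections onto `ker Φ x`.
These carry `ker Φ x₀` isomorphically onto `ker Φ x`, which is a copy of `E(L, V) x`.

Independence (`toK_sub_toK_eq`). The sum of two transversal subbundles need not be a subbundle, so
they are compared directly. Each `Vᵢ` gives a global morphism inverting `L` from the right modulo
`Vᵢ` (`exists_parametrix`), and from two of these an explicit isomorphism `E(L, V₁) ⊕ V₂ ≅ E(L, V₂)
⊕ V₁` is written down (`exchangeEquiv`). -/

theorem isOpen_setOf_isUnit {C : Y → R} {U : Set Y} (hU : IsOpen U) (hC : ContinuousOn C U) :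
    IsOpen {y | y ∈ U ∧ IsUnit (C y)} :=
  hC.isOpen_inter_preimage hU Units.isOpen

theorem continuousOn_inverse {C : Y → R} {U : Set Y} (hC : ContinuousOn C U) :
    ContinuousOn (fun y => Ring.inverse (C y)) {y | y ∈ U ∧ IsUnit (C y)} := by
  rintro y ⟨hy, u, hu⟩
  have h := NormedRing.inverse_continuousAt u
  rw [hu] at h
  exact h.comp_continuousWithinAt ((hC y hy).mono fun z hz => hz.1)

end Inverse

/-! ### One-sided inverses of operators with finite dimensional domain or kernel. -/

section Operators

variable {𝕜 : Type*} [RCLike 𝕜] {G H : Type*} [NormedAddCommGroup G] [NormedSpace 𝕜 G]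
  [NormedAddCommGroup H] [NormedSpace 𝕜 H]

theorem exists_leftInverse_of_finiteDimensional [FiniteDimensional 𝕜 H] {T : H →L[𝕜] G}
    (hT : Function.Injective T) : ∃ S : G →L[𝕜] H, S ∘L T = .id 𝕜 H := by
  obtain ⟨g, hg⟩ := LinearMap.exists_leftInverse_of_injective (T : H →ₗ[𝕜] G)
    (LinearMap.ker_eq_bot.2 hT)
  have hfin : FiniteDimensional 𝕜 T.range := LinearMap.finiteDimensional_range _
  obtain ⟨P, hP⟩ := Submodule.ClosedComplemented.of_finiteDimensional (𝕜 := 𝕜) T.range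
  refine ⟨(LinearMap.toContinuousLinearMap (g ∘ₗ T.range.subtype)) ∘L P, ?_⟩
  ext x
  have := hP ⟨T x, ⟨x, rfl⟩⟩
  simpa [this] using LinearMap.congr_fun hg x

/-- A finite dimensional kernel is complemented, and by the open mapping theorem `T` is an
isomorphism from the complement onto `G`. -/
theorem exists_rightInverse_of_surjective [CompleteSpace G] [CompleteSpace H] {T : H →L[𝕜] G}
    (hT : Function.Surjective T) (hker : FiniteDimensional 𝕜 T.ker) :
    ∃ S : G →L[𝕜] H, T ∘L S = .id 𝕜 G := by
  obtain ⟨P, hP⟩ := Submodule.ClosedComplemented.of_finiteDimensional (𝕜 := 𝕜) T.ker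
  have hP' : P.range = ⊤ := LinearMap.range_eq_top.2 fun k => ⟨k, hP k⟩
  have hc : IsCompl T.ker P.ker := LinearMap.isCompl_of_proj hP
  let e := ContinuousLinearMap.equivProdOfSurjectiveOfIsCompl T P
    (LinearMap.range_eq_top.2 hT) hP' hc
  refine ⟨(e.symm : G × T.ker →L[𝕜] H) ∘L ContinuousLinearMap.inl 𝕜 G T.ker, ?_⟩
  ext y
  have := e.apply_symm_apply (y, 0)
  rw [ContinuousLinearMap.equivProdOfSurjectiveOfIsCompl_apply] at this
  exact congrArg Prod.fst this

/-- The projection of this kernel to `H'` has finite dimensional image, and its own kernel embeds in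
`ker T`. -/
theorem finiteDimensional_ker_coprod {H' : Type*} [NormedAddCommGroup H'] [NormedSpace 𝕜 H']
    [FiniteDimensional 𝕜 H'] (T : H →L[𝕜] G) (hT : FiniteDimensional 𝕜 T.ker) (s : H' →L[𝕜] G) :
    FiniteDimensional 𝕜 (T.coprod s).ker := by
  let p : (T.coprod s).ker →ₗ[𝕜] H' := LinearMap.snd 𝕜 H H' ∘ₗ (T.coprod s).ker.subtype
  have hp : FiniteDimensional 𝕜 (LinearMap.ker p) := by
    let q : LinearMap.ker p →ₗ[𝕜] T.ker :=
      LinearMap.codRestrict _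
        (LinearMap.fst 𝕜 H H' ∘ₗ (T.coprod s).ker.subtype ∘ₗ (LinearMap.ker p).subtype) (by
          rintro ⟨⟨⟨a, b⟩, hab⟩, h⟩
          have hb : b = 0 := h
          subst hb
          simpa using hab)
    refine FiniteDimensional.of_injective q fun x y hxy => ?_
    obtain ⟨⟨⟨a, b⟩, hab⟩, h⟩ := x
    obtain ⟨⟨⟨a', b'⟩, hab'⟩, h'⟩ := y
    have hb : b = 0 := h
    have hb' : b' = 0 := h'
    have ha : a = a' := congrArg Subtype.val hxy
    subst hb hb' ha
    rfl
  have := Module.Finite.equiv p.quotKerEquivRange.symm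
  exact Module.Finite.of_submodule_quotient (LinearMap.ker p)

end Operators

/-! ### Spans of compact sets in infinite dimensional Banach spaces. -/

section Span

variable {𝕜 : Type*} [RCLike 𝕜] {G : Type*} [NormedAddCommGroup G] [NormedSpace 𝕜 G]

/-- The combinations of length `n` are the continuous image of the σ-compact space `𝕜ⁿ × Kⁿ`. -/
theorem isSigmaCompact_span {K : Set G} (hK : IsCompact K) :
    IsSigmaCompact (Submodule.span 𝕜 K : Set G) := by
  have : CompactSpace K := isCompact_iff_compactSpace.1 hK
  have h : (Submodule.span 𝕜 K : Set G) =
      ⋃ n : ℕ, range fun p : (Fin n → 𝕜) × (Fin n → K) => ∑ i, p.1 i • (p.2 i : G) := by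
    ext x
    simp [Submodule.mem_span_set']
  rw [h]
  refine isSigmaCompact_iUnion _ fun n => isSigmaCompact_range ?_
  fun_prop

/-- By Baire, one of the compact sets has an interior point, so some closed ball is compact and
Riesz's theorem applies. -/
theorem finiteDimensional_of_isSigmaCompact_univ [CompleteSpace G]
    (h : IsSigmaCompact (univ : Set G)) : FiniteDimensional 𝕜 G := by
  obtain ⟨K, hK, hKu⟩ := h
  obtain ⟨n, x, hx⟩ := nonempty_interior_of_iUnion_of_closed (fun n => (hK n).isClosed) hKu
  have hn : K n ∈ 𝓝 x := mem_interior_iff_mem_nhds.1 hx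
  obtain ⟨r, hr, hrK⟩ := Metric.nhds_basis_closedBall.mem_iff.1 hn
  exact FiniteDimensional.of_isCompact_closedBall 𝕜 hr
    ((hK n).of_isClosed_subset Metric.isClosed_closedBall hrK)

/-- The span of a compact set has infinite codimension, so it leaves room for any finite number of
independent directions. This is the source of the perturbations that make sections linearly
independent. -/
theorem exists_linearIndependent_mkQ_span [CompleteSpace G] (hG : ¬ FiniteDimensional 𝕜 G)
    {K : Set G} (hK : IsCompact K) (ι : Type) [Finite ι] :
    ∃ e : ι → G, LinearIndependent 𝕜 fun i => (Submodule.span 𝕜 K).mkQ (e i) := by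
  have hQ : ¬ Module.Finite 𝕜 (G ⧸ Submodule.span 𝕜 K) := by
    intro hfin
    obtain ⟨n, b, hb⟩ := Module.Finite.exists_fin (R := 𝕜) (M := G ⧸ Submodule.span 𝕜 K)
    choose c hc using fun i => Submodule.mkQ_surjective (Submodule.span 𝕜 K) (b i)
    refine hG (finiteDimensional_of_isSigmaCompact_univ ?_)
    -- Adjoining finitely many representatives of generators of the quotient keeps the set compact
    -- but makes its span everything, so `G` would be σ-compact.
    have hK' : IsCompact (K ∪ range c) := hK.union (finite_range c).isCompact
    have htop : Submodule.span 𝕜 (K ∪ range c) = ⊤ := by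
      rw [Submodule.span_union]
      have h1 : Submodule.map (Submodule.span 𝕜 K).mkQ (Submodule.span 𝕜 (range c)) = ⊤ := by
        rw [Submodule.map_span, ← range_comp, ← hb]
        exact congrArg (fun g => Submodule.span 𝕜 (range g)) (funext hc)
      rw [eq_top_iff]
      intro x _
      obtain ⟨y, hy, hyx⟩ := (h1 ▸ Submodule.mem_top :
        (Submodule.span 𝕜 K).mkQ x ∈ Submodule.map _ (Submodule.span 𝕜 (range c)))
      rw [← sub_add_cancel x y]
      refine Submodule.add_mem_sup ?_ hy
      rw [← Submodule.Quotient.mk_eq_zero, Submodule.Quotient.mk_sub]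
      exact sub_eq_zero.2 hyx.symm
    have := isSigmaCompact_span (𝕜 := 𝕜) hK'
    rwa [htop] at this
  have := Fintype.ofFinite ι
  have hr : Cardinal.aleph0 ≤ Module.rank 𝕜 (G ⧸ Submodule.span 𝕜 K) := by
    by_contra! h
    exact hQ (Module.rank_lt_aleph0_iff.1 h)
  obtain ⟨f, hf⟩ := exists_linearIndependent_of_le_rank (R := 𝕜)
    ((Cardinal.natCast_lt_aleph0 (n := Fintype.card ι)).le.trans hr)
  choose c hc using fun i => Submodule.mkQ_surjective (Submodule.span 𝕜 K) (f i)
  refine ⟨fun i => c (Fintype.equivFin ι i), ?_⟩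
  simp only [hc]
  exact hf.comp _ (Fintype.equivFin ι).injective

end Span

/-! ### Openness of surjectivity, and maps out of `𝕜^ι`. -/

section EventuallySurjective

variable {𝕜 : Type*} [RCLike 𝕜] {G H : Type*} [NormedAddCommGroup G] [NormedSpace 𝕜 G]
  [NormedAddCommGroup H] [NormedSpace 𝕜 H]

/-- If `S` is a right inverse of `T`, then `T' ∘ S` stays invertible for `T'` near `T`. -/
theorem eventually_surjective [CompleteSpace G] [CompleteSpace H] {T : H →L[𝕜] G}
    (hT : Function.Surjective T) (hker : FiniteDimensional 𝕜 T.ker) :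
    ∀ᶠ T' : H →L[𝕜] G in 𝓝 T, Function.Surjective T' := by
  obtain ⟨S, hS⟩ := exists_rightInverse_of_surjective hT hker
  have hc : Continuous fun T' : H →L[𝕜] G => T' ∘L S := by fun_prop
  have h1 : IsUnit (T ∘L S : G →L[𝕜] G) := hS ▸ isUnit_one
  filter_upwards [hc.continuousAt.preimage_mem_nhds (Units.isOpen.mem_nhds h1)] with T' hT' y
  obtain ⟨u, hu⟩ : IsUnit (T' ∘L S) := hT'
  refine ⟨S (((u⁻¹ : (G →L[𝕜] G)ˣ) : G →L[𝕜] G) y), ?_⟩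
  have : ((u : G →L[𝕜] G) * ((u⁻¹ : (G →L[𝕜] G)ˣ) : G →L[𝕜] G)) y = y := by simp
  rwa [hu] at this

variable {ι : Type*} [Fintype ι]

/-- The linear map `𝕜^ι → G` with given values on the standard basis. -/
def combination (a : ι → G) : (ι → 𝕜) →L[𝕜] G :=
  ∑ i, (ContinuousLinearMap.proj i : (ι → 𝕜) →L[𝕜] 𝕜).smulRight (a i)

theorem combination_apply (a : ι → G) (c : ι → 𝕜) : combination a c = ∑ i, c i • a i := by
  simp [combination]

theorem continuous_combination : Continuous (combination (𝕜 := 𝕜) : (ι → G) → _) := by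
  rw [continuous_clm_apply]
  intro c
  simp only [combination_apply]
  fun_prop

theorem combination_injective {a : ι → G} (h : LinearIndependent 𝕜 a) :
    Function.Injective (combination (𝕜 := 𝕜) a) := by
  rw [linearIndependent_iff_injective_fintypeLinearCombination] at h
  intro c d hcd
  apply h
  simpa [combination_apply, Fintype.linearCombination_apply] using hcd

end EventuallySurjective

/-! ### Sections of vector bundles -/

section Sections

variable {𝕜 : Type*} [RCLike 𝕜] {X : Type u} [TopologicalSpace X]
  {E₀ : Type*} [NormedAddCommGroup E₀] [NormedSpace 𝕜 E₀]
  {E : X → Type*} [∀ x, AddCommGroup (E x)] [∀ x, Module 𝕜 (E x)] [∀ x, TopologicalSpace (E x)]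
  [TopologicalSpace (TotalSpace E₀ E)] [FiberBundle E₀ E] [VectorBundle 𝕜 E₀ E]
  {F₀ : Type*} [NormedAddCommGroup F₀] [NormedSpace 𝕜 F₀]
  {F : X → Type*} [∀ x, AddCommGroup (F x)] [∀ x, Module 𝕜 (F x)] [∀ x, TopologicalSpace (F x)]
  [∀ x, IsTopologicalAddGroup (F x)] [∀ x, ContinuousSMul 𝕜 (F x)]
  [TopologicalSpace (TotalSpace F₀ F)] [FiberBundle F₀ F] [VectorBundle 𝕜 F₀ F]
  {Y : Type*} [TopologicalSpace Y] {b : Y → X} {y₀ : Y}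

variable (𝕜) in
-- Sections are taken along an arbitrary map `b : Y → X`: later `Y` is a total space, or `𝕜 × X` for
-- a perturbation depending on a parameter.
theorem continuousAt_section_iff (e : Trivialization E₀ (π E₀ E)) [MemTrivializationAtlas e]
    {s : ∀ y, E (b y)} (hy : b y₀ ∈ e.baseSet) :
    ContinuousAt (fun y => TotalSpace.mk' E₀ (b y) (s y)) y₀ ↔
      ContinuousAt b y₀ ∧ ContinuousAt (fun y => e.continuousLinearMapAt 𝕜 (b y) (s y)) y₀ := by
  have h : ContinuousAt (fun y => TotalSpace.mk' E₀ (b y) (s y)) y₀ ↔ ContinuousAt b y₀ ∧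
      ContinuousAt (fun y => (e (TotalSpace.mk' E₀ (b y) (s y))).2) y₀ :=
    e.tendsto_nhds_iff (e.mem_source.2 hy)
  rw [h]
  refine and_congr_right fun hb => continuousAt_congr ?_
  filter_upwards [hb.preimage_mem_nhds (e.open_baseSet.mem_nhds hy)] with y hy'
  exact (e.continuousLinearMapAt_apply_of_mem 𝕜 hy' _).symm

variable (𝕜) in
theorem continuousAt_hom_section_iff (e : Trivialization E₀ (π E₀ E)) [MemTrivializationAtlas e]
    (f : Trivialization F₀ (π F₀ F)) [MemTrivializationAtlas f]
    {L : ∀ y, E (b y) →L[𝕜] F (b y)} (hy : b y₀ ∈ e.baseSet) (hy' : b y₀ ∈ f.baseSet) :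
    ContinuousAt (fun y => TotalSpace.mk' (E₀ →L[𝕜] F₀)
        (E := fun x => E x →L[𝕜] F x) (b y) (L y)) y₀ ↔
      ContinuousAt b y₀ ∧ ContinuousAt (fun y =>
        f.continuousLinearMapAt 𝕜 (b y) ∘L L y ∘L e.symmL 𝕜 (b y)) y₀ := by
  let h := e.continuousLinearMap (RingHom.id 𝕜) f
  have hh : b y₀ ∈ h.baseSet := ⟨hy, hy'⟩
  exact h.tendsto_nhds_iff (h.mem_source.2 hh)

theorem continuousAt_section_smul {s : ∀ y, E (b y)} {c : Y → 𝕜} (hc : ContinuousAt c y₀)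
    (hs : ContinuousAt (fun y => TotalSpace.mk' E₀ (b y) (s y)) y₀) :
    ContinuousAt (fun y => TotalSpace.mk' E₀ (b y) (c y • s y)) y₀ := by
  have hy := mem_baseSet_trivializationAt E₀ E (b y₀)
  rw [continuousAt_section_iff 𝕜 _ hy] at *
  simpa only [map_smul] using ⟨hs.1, hc.smul hs.2⟩

theorem continuous_section_smul {s : ∀ y, E (b y)} {c : Y → 𝕜} (hc : Continuous c)
    (hs : Continuous (fun y => TotalSpace.mk' E₀ (b y) (s y))) :
    Continuous (fun y => TotalSpace.mk' E₀ (b y) (c y • s y)) :=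
  continuous_iff_continuousAt.2 fun _ => continuousAt_section_smul hc.continuousAt hs.continuousAt

variable (𝕜) in
/-- A section which is continuous on an open set, multiplied with a function supported in this set,
is continuous everywhere. -/
theorem continuous_section_smul_of_tsupport_subset {s : ∀ x, E x} {c : X → 𝕜} {U : Set X}
    (hc : Continuous c) (hcU : tsupport c ⊆ U)
    (hs : ∀ x ∈ U, ContinuousAt (fun x => TotalSpace.mk' E₀ x (s x)) x) :
    Continuous (fun x => TotalSpace.mk' E₀ x (c x • s x)) := by
  refine continuous_iff_continuousAt.2 fun x => ?_
  by_cases hx : x ∈ tsupport c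
  · exact continuousAt_section_smul (b := fun x => x) hc.continuousAt (hs x (hcU hx))
  · refine (Bundle.Trivialization.continuousAt_zeroSection 𝕜 x (F := E₀) (E := E)).congr ?_
    filter_upwards [(isClosed_tsupport c).isOpen_compl.mem_nhds hx] with z hz
    have : c z = 0 := image_eq_zero_of_notMem_tsupport hz
    rw [this, zero_smul]
    rfl

/-- The constant section in a local trivialization is continuous. -/
theorem continuousAt_symmL (e : Trivialization E₀ (π E₀ E)) [MemTrivializationAtlas e]
    {a : X → E₀} {x : X} (ha : ContinuousAt a x) (hx : x ∈ e.baseSet) :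
    ContinuousAt (fun x => TotalSpace.mk' E₀ x (e.symmL 𝕜 x (a x))) x := by
  rw [continuousAt_section_iff 𝕜 (b := fun x => x) e hx]
  refine ⟨continuousAt_id, ha.congr ?_⟩
  filter_upwards [e.open_baseSet.mem_nhds hx] with z hz
  rw [e.continuousLinearMapAt_symmL hz]

end Sections

section SectionsAdd

variable {X : Type u} [TopologicalSpace X] {E₀ : Type*} [NormedAddCommGroup E₀]
  {E : X → Type*} [∀ x, AddCommGroup (E x)] [∀ x, TopologicalSpace (E x)]
  [TopologicalSpace (TotalSpace E₀ E)] [FiberBundle E₀ E]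
  {Y : Type*} [TopologicalSpace Y] {b : Y → X} {y₀ : Y}

theorem continuousAt_section_add (𝕜 : Type*) [RCLike 𝕜] [NormedSpace 𝕜 E₀]
    [∀ x, Module 𝕜 (E x)] [VectorBundle 𝕜 E₀ E] {s t : ∀ y, E (b y)}
    (hs : ContinuousAt (fun y => TotalSpace.mk' E₀ (b y) (s y)) y₀)
    (ht : ContinuousAt (fun y => TotalSpace.mk' E₀ (b y) (t y)) y₀) :
    ContinuousAt (fun y => TotalSpace.mk' E₀ (b y) (s y + t y)) y₀ := by
  have hy := mem_baseSet_trivializationAt E₀ E (b y₀)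
  rw [continuousAt_section_iff 𝕜 _ hy] at *
  simpa only [map_add] using ⟨hs.1, hs.2.add ht.2⟩

theorem continuous_section_add (𝕜 : Type*) [RCLike 𝕜] [NormedSpace 𝕜 E₀]
    [∀ x, Module 𝕜 (E x)] [VectorBundle 𝕜 E₀ E] {s t : ∀ y, E (b y)}
    (hs : Continuous (fun y => TotalSpace.mk' E₀ (b y) (s y)))
    (ht : Continuous (fun y => TotalSpace.mk' E₀ (b y) (t y))) :
    Continuous (fun y => TotalSpace.mk' E₀ (b y) (s y + t y)) :=
  continuous_iff_continuousAt.2 fun _ =>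
    continuousAt_section_add 𝕜 hs.continuousAt ht.continuousAt

theorem continuous_section_sub (𝕜 : Type*) [RCLike 𝕜] [NormedSpace 𝕜 E₀]
    [∀ x, Module 𝕜 (E x)] [VectorBundle 𝕜 E₀ E] {s t : ∀ y, E (b y)}
    (hs : Continuous (fun y => TotalSpace.mk' E₀ (b y) (s y)))
    (ht : Continuous (fun y => TotalSpace.mk' E₀ (b y) (t y))) :
    Continuous (fun y => TotalSpace.mk' E₀ (b y) (s y - t y)) := by
  have := continuous_section_add 𝕜 hs
    (continuous_section_smul (continuous_const (y := (-1 : 𝕜))) ht)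
  simpa only [neg_smul, one_smul, ← sub_eq_add_neg] using this

end SectionsAdd

/-- Urysohn functions with values in `𝕜`. -/
theorem exists_bump (𝕜 : Type*) [RCLike 𝕜] {X : Type*} [TopologicalSpace X] [CompactSpace X]
    [T2Space X] {U : Set X} (hU : IsOpen U) {x₀ : X} (hx : x₀ ∈ U) :
    ∃ (K : Set X) (χ : X → ℝ), K ∈ 𝓝 x₀ ∧ IsClosed K ∧ K ⊆ U ∧ Continuous χ ∧ (∀ x, 0 ≤ χ x) ∧
      (∀ x ∈ K, χ x = 1) ∧ tsupport (fun x => (χ x : 𝕜)) ⊆ U := by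
  obtain ⟨V, hV, hVc, hVU⟩ := exists_mem_nhds_isClosed_subset (hU.mem_nhds hx)
  obtain ⟨K, hK, hKc, hKV⟩ := exists_mem_nhds_isClosed_subset
    (isOpen_interior.mem_nhds (mem_interior_iff_mem_nhds.2 hV))
  obtain ⟨f, hf0, hf1, hf⟩ := exists_continuous_zero_one_of_isClosed
    (isOpen_interior (s := V)).isClosed_compl hKc
    (disjoint_compl_left_iff_subset.2 hKV)
  refine ⟨K, f, hK, hKc, hKV.trans (interior_subset.trans hVU), f.continuous, fun x => (hf x).1,
    hf1, ?_⟩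
  refine (closure_minimal ?_ hVc).trans hVU
  intro x hx
  by_contra h
  refine hx ?_
  have : f x = 0 := hf0 fun h' => h (interior_subset h')
  simp [this]

/-! ### Local triviality -/

section LocalFraming

variable {𝕜 : Type*} [RCLike 𝕜] {X : Type u} [TopologicalSpace X] {A : X → Type v}
  [∀ x, AddCommGroup (A x)] [∀ x, Module 𝕜 (A x)] [TopologicalSpace (TotalSpace Unit A)]

/-- A local trivialization over `U`, given as a family of linear maps `k` from the model fibre,
together with the inverse `f` of the map of total spaces defined by `k`. -/
structure IsLocalFraming {H : Type*} [NormedAddCommGroup H] [NormedSpace 𝕜 H] (U : Set X)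
    (k : ∀ x, H →ₗ[𝕜] A x) (f : TotalSpace Unit A → H) : Prop where
  isOpen : IsOpen U
  continuousOn_left : ContinuousOn (fun q : X × H => (⟨q.1, k q.1 q.2⟩ : TotalSpace Unit A))
    (U ×ˢ univ)
  continuousOn_right : ContinuousOn f (π Unit A ⁻¹' U)
  right_left : ∀ x ∈ U, ∀ c, f ⟨x, k x c⟩ = c
  left_right : ∀ x ∈ U, ∀ a : A x, k x (f ⟨x, a⟩) = a

theorem IsFiniteDimBundle.continuous_proj (h : IsFiniteDimBundle 𝕜 A) :
    Continuous (π Unit A) :=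
  continuous_iff_continuousAt.2 fun p => by
    obtain ⟨n, e, he, -⟩ := h p.1
    exact e.continuousAt_proj (e.mem_source.2 he)

theorem IsFiniteDimBundle.exists_isLocalFraming (h : IsFiniteDimBundle 𝕜 A) (x₀ : X) :
    ∃ (n : ℕ) (U : Set X) (k : ∀ x, (Fin n → 𝕜) →ₗ[𝕜] A x) (f : TotalSpace Unit A → Fin n → 𝕜),
      x₀ ∈ U ∧ IsLocalFraming U k f := by
  classical
  obtain ⟨n, e, he, hlin⟩ := h x₀
  have hinj : ∀ x ∈ e.baseSet, Function.Injective fun w : A x => (e ⟨x, w⟩).2 := by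
    intro x hx w w' hww
    have h1 : e ⟨x, w⟩ = e ⟨x, w'⟩ :=
      Prod.ext (by rw [e.coe_fst' hx, e.coe_fst' hx]) hww
    have := e.injOn (e.mem_source.2 hx) (e.mem_source.2 hx) h1
    simpa using this
  have hsurj : ∀ x ∈ e.baseSet, Function.Surjective fun w : A x => (e ⟨x, w⟩).2 := by
    intro x hx c
    have hm : (x, c) ∈ e.target := e.mem_target.2 hx
    have h1 := e.apply_symm_apply hm
    have h2 := e.proj_symm_apply hm
    revert h1 h2
    -- The base point of this preimage is `x` only propositionally; naming the preimage allows the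
    -- two fibres to be identified by `rfl`.
    generalize e.toOpenPartialHomeomorph.symm (x, c) = p
    intro h1 h2
    obtain ⟨y, w⟩ := p
    obtain rfl : y = x := h2
    exact ⟨w, congrArg Prod.snd h1⟩
  let ψ : ∀ x, x ∈ e.baseSet → A x ≃ₗ[𝕜] (Fin n → 𝕜) := fun x hx =>
    LinearEquiv.ofBijective ((hlin x hx).mk' _) ⟨hinj x hx, hsurj x hx⟩
  have hψ : ∀ x (hx : x ∈ e.baseSet) (w : A x), ψ x hx w = (e ⟨x, w⟩).2 := fun x hx w => rfl
  refine ⟨n, e.baseSet, fun x => if hx : x ∈ e.baseSet then (ψ x hx).symm else 0,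
    fun p => (e p).2, he, e.open_baseSet, ?_, ?_, ?_, ?_⟩
  · have h1 := e.toOpenPartialHomeomorph.continuousOn_symm
    rw [e.target_eq] at h1
    refine h1.congr ?_
    rintro ⟨x, c⟩ ⟨hx, -⟩
    have hx : x ∈ e.baseSet := hx
    have h2 : e ⟨x, (ψ x hx).symm c⟩ = (x, c) := by
      refine Prod.ext (e.coe_fst' hx) ?_
      rw [← hψ x hx]
      simp
    simp only [hx, dif_pos]
    have h3 := e.toOpenPartialHomeomorph.left_inv (e.mem_source.2 hx :
      (⟨x, (ψ x hx).symm c⟩ : TotalSpace Unit A) ∈ e.source)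
    exact h3.symm.trans (congrArg _ h2)
  · rw [← e.source_eq]
    exact e.toOpenPartialHomeomorph.continuousOn.snd
  · intro x hx c
    simp only [hx, dif_pos]
    rw [← hψ x hx]
    simp
  · intro x hx a
    simp only [hx, dif_pos]
    rw [← hψ x hx]
    simp

theorem IsLocalFraming.comp_equiv {H H' : Type*} [NormedAddCommGroup H] [NormedSpace 𝕜 H]
    [NormedAddCommGroup H'] [NormedSpace 𝕜 H'] {U : Set X} {k : ∀ x, H →ₗ[𝕜] A x}
    {f : TotalSpace Unit A → H} (h : IsLocalFraming U k f) (φ : H' ≃L[𝕜] H) :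
    IsLocalFraming U (fun x => k x ∘ₗ φ.toLinearEquiv.toLinearMap) fun p => φ.symm (f p) where
  isOpen := h.isOpen
  continuousOn_left := by
    have : ContinuousOn (fun q : X × H' => (q.1, φ q.2)) (U ×ˢ univ) := by fun_prop
    exact h.continuousOn_left.comp this fun q hq => ⟨hq.1, mem_univ _⟩
  continuousOn_right := φ.symm.continuous.comp_continuousOn h.continuousOn_right
  right_left x hx c := by simp [h.right_left x hx]
  left_right x hx c := by simp [h.left_right x hx]

theorem isFiniteDimBundle_of_isLocalFraming (hπ : Continuous (π Unit A))
    (h : ∀ x₀ : X, ∃ (n : ℕ) (U : Set X) (k : ∀ x, (Fin n → 𝕜) →ₗ[𝕜] A x)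
      (f : TotalSpace Unit A → Fin n → 𝕜), x₀ ∈ U ∧ IsLocalFraming U k f) :
    IsFiniteDimBundle 𝕜 A := by
  intro x₀
  obtain ⟨n, U, k, f, hx, h⟩ := h x₀
  let e : Trivialization (Fin n → 𝕜) (π Unit A) :=
    { toFun := fun p => (p.1, f p)
      invFun := fun q => ⟨q.1, k q.1 q.2⟩
      source := π Unit A ⁻¹' U
      target := U ×ˢ univ
      map_source' := fun p hp => ⟨hp, mem_univ _⟩
      map_target' := fun q hq => hq.1
      left_inv' := fun p hp => by rw [h.left_right p.1 hp p.2]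
      right_inv' := fun q hq => by rw [h.right_left q.1 hq.1]
      open_source := h.isOpen.preimage hπ
      open_target := h.isOpen.prod isOpen_univ
      continuousOn_toFun := hπ.continuousOn.prodMk h.continuousOn_right
      continuousOn_invFun := h.continuousOn_left
      baseSet := U
      open_baseSet := h.isOpen
      source_eq := rfl
      target_eq := rfl
      proj_toFun := fun p _ => rfl }
  refine ⟨n, e, hx, fun y hy => ?_⟩
  have hy : y ∈ U := hy
  have hinj : Function.Injective (k y) := fun c d hcd => by
    rw [← h.right_left y hy c, hcd, h.right_left y hy]
  change IsLinearMap 𝕜 fun w : A y => f ⟨y, w⟩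
  constructor
  · intro a b
    apply hinj
    rw [map_add]
    simp only [h.left_right y hy]
  · intro c a
    apply hinj
    rw [map_smul]
    simp only [h.left_right y hy]

variable {B C : X → Type v}
  [∀ x, AddCommGroup (B x)] [∀ x, Module 𝕜 (B x)] [TopologicalSpace (TotalSpace Unit B)]
  [∀ x, AddCommGroup (C x)] [∀ x, Module 𝕜 (C x)] [TopologicalSpace (TotalSpace Unit C)]

/-- A fibrewise direct sum of two vector bundles is a vector bundle. -/
theorem isFiniteDimBundle_of_isInducing (hB : IsFiniteDimBundle 𝕜 B) (hC : IsFiniteDimBundle 𝕜 C)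
    (φ : ∀ x, A x ≃ₗ[𝕜] B x × C x)
    (hφ : IsInducing fun p : TotalSpace Unit A =>
      ((⟨p.1, (φ p.1 p.2).1⟩, ⟨p.1, (φ p.1 p.2).2⟩) : TotalSpace Unit B × TotalSpace Unit C)) :
    IsFiniteDimBundle 𝕜 A := by
  have hπ : Continuous (π Unit A) :=
    hB.continuous_proj.comp (continuous_fst.comp hφ.continuous)
  refine isFiniteDimBundle_of_isLocalFraming hπ fun x₀ => ?_
  obtain ⟨n, U, k, f, hx, h⟩ := hB.exists_isLocalFraming x₀
  obtain ⟨m, U', k', f', hx', h'⟩ := hC.exists_isLocalFraming x₀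
  have key : IsLocalFraming (A := A) (H := (Fin n → 𝕜) × (Fin m → 𝕜)) (U ∩ U')
      (fun x => (φ x).symm.toLinearMap ∘ₗ (k x).prodMap (k' x))
      (fun p => (f ⟨p.1, (φ p.1 p.2).1⟩, f' ⟨p.1, (φ p.1 p.2).2⟩)) := by
    refine ⟨h.isOpen.inter h'.isOpen, ?_, ?_, ?_, ?_⟩
    · rw [hφ.continuousOn_iff]
      have h1 : ContinuousOn (fun q : X × ((Fin n → 𝕜) × (Fin m → 𝕜)) => (q.1, q.2.1))
        ((U ∩ U') ×ˢ univ) := by fun_prop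
      have h2 : ContinuousOn (fun q : X × ((Fin n → 𝕜) × (Fin m → 𝕜)) => (q.1, q.2.2))
        ((U ∩ U') ×ˢ univ) := by fun_prop
      have h3 := (h.continuousOn_left.comp h1 fun q hq => ⟨hq.1.1, mem_univ _⟩).prodMk
        (h'.continuousOn_left.comp h2 fun q hq => ⟨hq.1.2, mem_univ _⟩)
      refine h3.congr fun q hq => ?_
      simp
    · refine ContinuousOn.prodMk ?_ ?_
      · exact h.continuousOn_right.comp (continuous_fst.comp hφ.continuous).continuousOn
          fun p hp => hp.1
      · exact h'.continuousOn_right.comp (continuous_snd.comp hφ.continuous).continuousOn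
          fun p hp => hp.2
    · intro x hx c
      simp [h.right_left x hx.1, h'.right_left x hx.2]
    · intro x hx a
      simp [h.left_right x hx.1, h'.left_right x hx.2]
  let ε : (Fin (n + m) → 𝕜) ≃L[𝕜] (Fin n → 𝕜) × (Fin m → 𝕜) :=
    ContinuousLinearEquiv.ofFinrankEq (by simp)
  exact ⟨n + m, U ∩ U', _, _, ⟨hx, hx'⟩, key.comp_equiv ε⟩

end LocalFraming

/-! ### Subbundles and local frames -/

section LocalFrame

variable {𝕜 : Type*} [RCLike 𝕜] {X : Type u} [TopologicalSpace X]
  {E₀ : Type*} [NormedAddCommGroup E₀] [NormedSpace 𝕜 E₀]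
  {E : X → Type v} [∀ x, AddCommGroup (E x)] [∀ x, Module 𝕜 (E x)] [∀ x, TopologicalSpace (E x)]
  [TopologicalSpace (TotalSpace E₀ E)] [FiberBundle E₀ E] [VectorBundle 𝕜 E₀ E]

/-- A norm continuous family of injective linear maps `w x : H → E₀` which, in the trivialization
`e`, have the subspaces `W x` as their images. -/
structure IsLocalFrame (W : ∀ x, Submodule 𝕜 (E x)) (e : Trivialization E₀ (π E₀ E))
    [MemTrivializationAtlas e] {H : Type*} [NormedAddCommGroup H] [NormedSpace 𝕜 H]
    (U : Set X) (w : X → H →L[𝕜] E₀) : Prop where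
  isOpen : IsOpen U
  subset : U ⊆ e.baseSet
  continuousOn : ContinuousOn w U
  injective : ∀ x ∈ U, Function.Injective (w x)
  mem_iff : ∀ x ∈ U, ∀ v : E x, v ∈ W x ↔ ∃ c, w x c = e.continuousLinearMapAt 𝕜 x v

theorem IsLocalFrame.symmL_mem {W : ∀ x, Submodule 𝕜 (E x)} {e : Trivialization E₀ (π E₀ E)}
    [MemTrivializationAtlas e] {H : Type*} [NormedAddCommGroup H] [NormedSpace 𝕜 H]
    {U : Set X} {w : X → H →L[𝕜] E₀} (h : IsLocalFrame W e U w) {x : X} (hx : x ∈ U) (c : H) :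
    e.symmL 𝕜 x (w x c) ∈ W x :=
  (h.mem_iff x hx _).2 ⟨c, by rw [e.continuousLinearMapAt_symmL (h.subset hx)]⟩

/-- A left inverse `R` of the frame at `x₀` makes `R ∘ w x` invertible nearby, and `(R ∘ w x)⁻¹ ∘ R`
then reads off coordinates continuously. -/
theorem isFiniteDimBundle_of_isLocalFrame (W : ∀ x, Submodule 𝕜 (E x))
    (h : ∀ x₀ : X, ∃ (n : ℕ) (e : Trivialization E₀ (π E₀ E)) (_ : MemTrivializationAtlas e)
      (U : Set X) (w : X → (Fin n → 𝕜) →L[𝕜] E₀), x₀ ∈ U ∧ IsLocalFrame W e U w) :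
    letI := subspaceTopology 𝕜 E₀ E W
    IsFiniteDimBundle 𝕜 fun x => W x := by
  classical
  let := subspaceTopology 𝕜 E₀ E W
  have hind : IsInducing fun p : TotalSpace Unit fun x => W x =>
    (⟨p.1, (p.2 : E p.1)⟩ : TotalSpace E₀ E) := ⟨rfl⟩
  refine isFiniteDimBundle_of_isLocalFraming
    ((FiberBundle.continuous_proj E₀ E).comp hind.continuous) fun x₀ => ?_
  obtain ⟨n, e, _, U, w, hx₀, h⟩ := h x₀
  obtain ⟨R, hR⟩ := exists_leftInverse_of_finiteDimensional (h.injective x₀ hx₀)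
  have hC : ContinuousOn (fun x => R ∘L w x) U := continuousOn_const.clm_comp h.continuousOn
  let U' := {x | x ∈ U ∧ IsUnit (R ∘L w x)}
  have hU' : IsOpen U' := isOpen_setOf_isUnit h.isOpen hC
  have hA : ContinuousOn (fun x => Ring.inverse (R ∘L w x)) U' := continuousOn_inverse hC
  have hA' : ∀ x ∈ U', ∀ c, Ring.inverse (R ∘L w x) (R (w x c)) = c := fun x hx c => by
    have := Ring.inverse_mul_cancel _ hx.2
    exact DFunLike.congr_fun this c
  refine ⟨n, U', fun x => if hx : x ∈ U then
      LinearMap.codRestrict (W x) (e.symmL 𝕜 x ∘L w x : _ →L[𝕜] E x).toLinearMap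
        fun c => h.symmL_mem hx c else 0,
    fun p => Ring.inverse (R ∘L w p.1) (R (e.continuousLinearMapAt 𝕜 p.1 p.2)),
    ⟨hx₀, ?_⟩, hU', ?_, ?_, ?_, ?_⟩
  · rw [hR]
    exact isUnit_one
  · rw [hind.continuousOn_iff]
    intro q hq
    refine ContinuousAt.continuousWithinAt ?_
    have hqU : q.1 ∈ U := hq.1.1
    have hq' : ∀ᶠ r in 𝓝 q, r.1 ∈ U := continuousAt_fst.preimage_mem_nhds (h.isOpen.mem_nhds hqU)
    have h1 : ContinuousAt (fun q : X × (Fin n → 𝕜) =>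
        TotalSpace.mk' E₀ q.1 (e.symmL 𝕜 q.1 (w q.1 q.2))) q := by
      rw [continuousAt_section_iff 𝕜 (b := fun q : X × (Fin n → 𝕜) => q.1) e (h.subset hqU)]
      refine ⟨continuousAt_fst, ?_⟩
      have h2 : ContinuousAt (fun q : X × (Fin n → 𝕜) => w q.1 q.2) q :=
        ((h.continuousOn.continuousAt (h.isOpen.mem_nhds hqU)).comp continuousAt_fst).clm_apply
          continuousAt_snd
      refine h2.congr ?_
      filter_upwards [hq'] with r hr
      rw [e.continuousLinearMapAt_symmL (h.subset hr)]
    refine h1.congr ?_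
    filter_upwards [hq'] with r hr
    simp only [Function.comp_apply, hr, dif_pos]
    rfl
  · intro p hp
    refine ContinuousAt.continuousWithinAt ?_
    have hp' : p.1 ∈ U' := hp
    have h1 : ContinuousAt (fun p : TotalSpace Unit fun x => W x =>
        TotalSpace.mk' E₀ p.1 (p.2 : E p.1)) p := hind.continuous.continuousAt
    rw [continuousAt_section_iff 𝕜 (b := fun p : TotalSpace Unit fun x => W x => p.1) e
      (h.subset hp'.1)] at h1
    have h2 : ContinuousAt (fun x => Ring.inverse (R ∘L w x)) p.1 :=
      hA.continuousAt (hU'.mem_nhds hp')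
    exact (h2.comp h1.1).clm_apply (R.continuous.continuousAt.comp h1.2)
  · intro x hx c
    simp only [hx.1, dif_pos]
    change Ring.inverse (R ∘L w x) (R (e.continuousLinearMapAt 𝕜 x (e.symmL 𝕜 x (w x c)))) = c
    rw [e.continuousLinearMapAt_symmL (h.subset hx.1), hA' x hx]
  · intro x hx a
    simp only [hx.1, dif_pos]
    obtain ⟨c, hc⟩ := (h.mem_iff x hx.1 a).1 a.2
    apply Subtype.ext
    change e.symmL 𝕜 x (w x (Ring.inverse (R ∘L w x) (R (e.continuousLinearMapAt 𝕜 x a)))) = a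
    rw [← hc, hA' x hx, hc, e.symmL_continuousLinearMapAt (h.subset hx.1)]

theorem FiniteDimSubbundle.exists_isLocalFrame (V : FiniteDimSubbundle 𝕜 E₀ E)
    (e : Trivialization E₀ (π E₀ E)) [MemTrivializationAtlas e] {x₀ : X} (hx₀ : x₀ ∈ e.baseSet) :
    ∃ (n : ℕ) (U : Set X) (w : X → (Fin n → 𝕜) →L[𝕜] E₀),
      x₀ ∈ U ∧ IsLocalFrame V.space e U w := by
  let := subspaceTopology 𝕜 E₀ E V.space
  have hind : IsInducing fun p : TotalSpace Unit fun x => V.space x =>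
    (⟨p.1, (p.2 : E p.1)⟩ : TotalSpace E₀ E) := ⟨rfl⟩
  obtain ⟨n, U, k, f, hx, h⟩ := V.isFiniteDimBundle.exists_isLocalFraming x₀
  refine ⟨n, U ∩ e.baseSet, fun x => LinearMap.toContinuousLinearMap
    ((e.continuousLinearMapAt 𝕜 x).toLinearMap ∘ₗ (V.space x).subtype ∘ₗ k x),
    ⟨hx, hx₀⟩, h.isOpen.inter e.open_baseSet, inter_subset_right, ?_, ?_, ?_⟩
  -- The domain `𝕜ⁿ` is finite dimensional, so pointwise continuity gives continuity in operator
  -- norm.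
  · rw [continuousOn_clm_apply]
    intro c x hx
    refine ContinuousAt.continuousWithinAt ?_
    have h1 : ContinuousAt (fun x => (⟨x, k x c⟩ : TotalSpace Unit fun x => V.space x)) x :=
      (h.continuousOn_left.continuousAt ((h.isOpen.prod isOpen_univ).mem_nhds
        ⟨hx.1, mem_univ c⟩)).comp (f := fun x : X => (x, c)) (by fun_prop)
    have h2 := hind.continuous.continuousAt.comp h1
    exact ((continuousAt_section_iff 𝕜 (b := fun x => x) (s := fun x => (k x c : E x)) e
      hx.2).1 h2).2
  · intro x hx c d hcd
    have h1 : e.continuousLinearMapAt 𝕜 x (k x c : E x) =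
      e.continuousLinearMapAt 𝕜 x (k x d : E x) := hcd
    have h2 := congrArg (e.symmL 𝕜 x) h1
    rw [e.symmL_continuousLinearMapAt hx.2, e.symmL_continuousLinearMapAt hx.2] at h2
    rw [← h.right_left x hx.1 c, Subtype.ext h2, h.right_left x hx.1]
  · intro x hx v
    constructor
    · intro hv
      refine ⟨f ⟨x, ⟨v, hv⟩⟩, ?_⟩
      change e.continuousLinearMapAt 𝕜 x (k x (f ⟨x, ⟨v, hv⟩⟩) : E x) = _
      rw [h.left_right x hx.1]
    · rintro ⟨c, hc⟩
      have h1 : e.continuousLinearMapAt 𝕜 x (k x c : E x) = e.continuousLinearMapAt 𝕜 x v := hc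
      have h2 := congrArg (e.symmL 𝕜 x) h1
      rw [e.symmL_continuousLinearMapAt hx.2, e.symmL_continuousLinearMapAt hx.2] at h2
      rw [← h2]
      exact (k x c).2

theorem IsLocalFrame.comp_equiv {W : ∀ x, Submodule 𝕜 (E x)} {e : Trivialization E₀ (π E₀ E)}
    [MemTrivializationAtlas e] {H H' : Type*} [NormedAddCommGroup H] [NormedSpace 𝕜 H]
    [NormedAddCommGroup H'] [NormedSpace 𝕜 H']
    {U : Set X} {w : X → H →L[𝕜] E₀} (h : IsLocalFrame W e U w) (φ : H' ≃L[𝕜] H) :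
    IsLocalFrame W e U fun x => w x ∘L (φ : H' →L[𝕜] H) where
  isOpen := h.isOpen
  subset := h.subset
  continuousOn := h.continuousOn.clm_comp continuousOn_const
  injective x hx := (h.injective x hx).comp φ.injective
  mem_iff x hx v := by
    rw [h.mem_iff x hx]
    exact ⟨fun ⟨c, hc⟩ => ⟨φ.symm c, by simpa using hc⟩, fun ⟨c, hc⟩ => ⟨φ c, hc⟩⟩

theorem IsLocalFrame.exists_fin {W : ∀ x, Submodule 𝕜 (E x)} {e : Trivialization E₀ (π E₀ E)}
    [MemTrivializationAtlas e] {H : Type*} [NormedAddCommGroup H] [NormedSpace 𝕜 H]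
    [FiniteDimensional 𝕜 H] {U : Set X} {w : X → H →L[𝕜] E₀} (h : IsLocalFrame W e U w) :
    ∃ (n : ℕ) (w' : X → (Fin n → 𝕜) →L[𝕜] E₀), IsLocalFrame W e U w' :=
  ⟨Module.finrank 𝕜 H, _, h.comp_equiv (ContinuousLinearEquiv.ofFinrankEq (by simp))⟩

end LocalFrame

/-! ### Local analysis of Fredholm morphisms -/

section LocalAnalysis

variable {𝕜 : Type*} [RCLike 𝕜] {X : Type u} [TopologicalSpace X]
  {E₀ : Type*} [NormedAddCommGroup E₀] [NormedSpace 𝕜 E₀]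
  {E : X → Type v} [∀ x, AddCommGroup (E x)] [∀ x, Module 𝕜 (E x)] [∀ x, TopologicalSpace (E x)]
  [TopologicalSpace (TotalSpace E₀ E)] [FiberBundle E₀ E] [VectorBundle 𝕜 E₀ E]
  {F₀ : Type*} [NormedAddCommGroup F₀] [NormedSpace 𝕜 F₀]
  {F : X → Type v} [∀ x, AddCommGroup (F x)] [∀ x, Module 𝕜 (F x)] [∀ x, TopologicalSpace (F x)]
  [TopologicalSpace (TotalSpace F₀ F)] [FiberBundle F₀ F] [VectorBundle 𝕜 F₀ F]

/-- A family of linear maps in local trivializations. -/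
def localRep (e : Trivialization E₀ (π E₀ E)) [MemTrivializationAtlas e]
    (f : Trivialization F₀ (π F₀ F)) [MemTrivializationAtlas f] (L : ∀ x, E x →L[𝕜] F x) (x : X) :
    E₀ →L[𝕜] F₀ :=
  f.continuousLinearMapAt 𝕜 x ∘L L x ∘L e.symmL 𝕜 x

theorem localRep_apply (e : Trivialization E₀ (π E₀ E)) [MemTrivializationAtlas e]
    (f : Trivialization F₀ (π F₀ F)) [MemTrivializationAtlas f] (L : ∀ x, E x →L[𝕜] F x) {x : X}
    (hx : x ∈ e.baseSet) (u : E x) :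
    localRep e f L x (e.continuousLinearMapAt 𝕜 x u) = f.continuousLinearMapAt 𝕜 x (L x u) := by
  simp only [localRep, ContinuousLinearMap.comp_apply]
  rw [e.symmL_continuousLinearMapAt hx]

theorem finiteDimensional_ker_localRep (e : Trivialization E₀ (π E₀ E)) [MemTrivializationAtlas e]
    (f : Trivialization F₀ (π F₀ F)) [MemTrivializationAtlas f] (L : ∀ x, E x →L[𝕜] F x) {x : X}
    (hx : x ∈ e.baseSet) (hx' : x ∈ f.baseSet) (hL : FiniteDimensional 𝕜 (L x).ker) :
    FiniteDimensional 𝕜 (localRep e f L x).ker := by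
  have h : (localRep e f L x).ker ≤
      Submodule.map (e.continuousLinearMapAt 𝕜 x).toLinearMap (L x).ker := by
    intro u hu
    refine ⟨e.symmL 𝕜 x u, ?_, e.continuousLinearMapAt_symmL hx u⟩
    have h1 : f.continuousLinearMapAt 𝕜 x (L x (e.symmL 𝕜 x u)) = 0 := hu
    have h2 := congrArg (f.symmL 𝕜 x) h1
    rwa [f.symmL_continuousLinearMapAt hx', map_zero] at h2
  exact Submodule.finiteDimensional_of_le h

/-- The map `(u, c) ↦ L u + s c` in local trivializations. -/
def augmented {H : Type*} [NormedAddCommGroup H] [NormedSpace 𝕜 H]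
    (T : E₀ →L[𝕜] F₀) (s : H →L[𝕜] F₀) : E₀ × H →L[𝕜] F₀ :=
  T ∘L ContinuousLinearMap.fst 𝕜 E₀ H + s ∘L ContinuousLinearMap.snd 𝕜 E₀ H

theorem augmented_apply {H : Type*} [NormedAddCommGroup H] [NormedSpace 𝕜 H]
    (T : E₀ →L[𝕜] F₀) (s : H →L[𝕜] F₀) (z : E₀ × H) : augmented T s z = T z.1 + s z.2 := rfl

theorem finiteDimensional_ker_augmented {H : Type*} [NormedAddCommGroup H] [NormedSpace 𝕜 H]
    [FiniteDimensional 𝕜 H] {T : E₀ →L[𝕜] F₀} (hT : FiniteDimensional 𝕜 T.ker) (s : H →L[𝕜] F₀) :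
    FiniteDimensional 𝕜 (augmented T s).ker := by
  have : augmented T s = T.coprod s := by ext z <;> simp [augmented_apply]
  rw [this]
  exact finiteDimensional_ker_coprod T hT s

variable [∀ x, IsTopologicalAddGroup (F x)] [∀ x, ContinuousSMul 𝕜 (F x)]

theorem IsMorphism.continuousAt_localRep {L : ∀ x, E x →L[𝕜] F x} (hL : IsMorphism E₀ F₀ L)
    (e : Trivialization E₀ (π E₀ E)) [MemTrivializationAtlas e]
    (f : Trivialization F₀ (π F₀ F)) [MemTrivializationAtlas f] {x : X}
    (hx : x ∈ e.baseSet) (hx' : x ∈ f.baseSet) : ContinuousAt (localRep e f L) x :=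
  ((continuousAt_hom_section_iff 𝕜 (b := fun x => x) e f hx hx').1 hL.continuousAt).2

/-- Near every point, the augmented map of a Fredholm morphism and a local frame of a transversal
subbundle has a continuous right inverse `S ∘ A x` whose image does not depend on `x`. -/
theorem exists_local_rightInverse [CompleteSpace E₀] [CompleteSpace F₀]
    {L : ∀ x, E x →L[𝕜] F x} (hL : IsMorphism E₀ F₀ L)
    (hker : ∀ x, FiniteDimensional 𝕜 (L x).ker) {V : FiniteDimSubbundle 𝕜 F₀ F}
    (hV : IsTransversal F₀ L V)
    (e : Trivialization E₀ (π E₀ E)) [MemTrivializationAtlas e]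
    (f : Trivialization F₀ (π F₀ F)) [MemTrivializationAtlas f] {x₀ : X}
    (hx : x₀ ∈ e.baseSet) (hx' : x₀ ∈ f.baseSet) :
    ∃ (n : ℕ) (U : Set X) (s : X → (Fin n → 𝕜) →L[𝕜] F₀) (S : F₀ →L[𝕜] E₀ × (Fin n → 𝕜))
      (A : X → F₀ →L[𝕜] F₀), x₀ ∈ U ∧ U ⊆ e.baseSet ∧ IsLocalFrame V.space f U s ∧
        ContinuousOn (fun x => augmented (localRep e f L x) (s x)) U ∧ ContinuousOn A U ∧
        (∀ x ∈ U, ∀ y, augmented (localRep e f L x) (s x) (S (A x y)) = y) ∧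
        (∀ x ∈ U, ∀ y, A x (augmented (localRep e f L x) (s x) (S y)) = y) ∧
        (∀ y, augmented (localRep e f L x₀) (s x₀) (S y) = y) ∧
        FiniteDimensional 𝕜 (augmented (localRep e f L x₀) (s x₀)).ker := by
  obtain ⟨n, U, s, hxU, hs⟩ := V.exists_isLocalFrame f hx'
  let Φ : X → E₀ × (Fin n → 𝕜) →L[𝕜] F₀ := fun x => augmented (localRep e f L x) (s x)
  have hfin : FiniteDimensional 𝕜 (Φ x₀).ker :=
    finiteDimensional_ker_augmented (finiteDimensional_ker_localRep e f L hx hx' (hker x₀)) _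
  have hsurj : Function.Surjective (Φ x₀) := by
    -- Surjectivity of the augmented map at `x₀` is exactly transversality there, read in the
    -- trivializations.
    intro y
    have h1 : f.symmL 𝕜 x₀ y ∈ (L x₀).range ⊔ V.space x₀ := hV x₀ ▸ Submodule.mem_top
    obtain ⟨_, ⟨u, rfl⟩, v, hv, huv⟩ := Submodule.mem_sup.1 h1
    obtain ⟨c, hc⟩ := (hs.mem_iff x₀ hxU v).1 hv
    refine ⟨(e.continuousLinearMapAt 𝕜 x₀ u, c), ?_⟩
    change localRep e f L x₀ (e.continuousLinearMapAt 𝕜 x₀ u) + s x₀ c = y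
    rw [localRep_apply e f L hx, hc, ← map_add]
    have h2 : L x₀ u + v = f.symmL 𝕜 x₀ y := huv
    rw [h2, f.continuousLinearMapAt_symmL hx']
  obtain ⟨S, hS⟩ := exists_rightInverse_of_surjective hsurj hfin
  have hΦ : ContinuousOn Φ (U ∩ e.baseSet) := by
    intro x hx
    refine ContinuousAt.continuousWithinAt ?_
    have h1 := hL.continuousAt_localRep e f hx.2 (hs.subset hx.1)
    have h2 := hs.continuousOn.continuousAt (hs.isOpen.mem_nhds hx.1)
    exact (h1.clm_comp continuousAt_const).add (h2.clm_comp continuousAt_const)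
  have hC : ContinuousOn (fun x => Φ x ∘L S) (U ∩ e.baseSet) := hΦ.clm_comp continuousOn_const
  let U' := {x | x ∈ U ∩ e.baseSet ∧ IsUnit (Φ x ∘L S)}
  have hU' : IsOpen U' := isOpen_setOf_isUnit (hs.isOpen.inter e.open_baseSet) hC
  refine ⟨n, U', s, S, fun x => Ring.inverse (Φ x ∘L S), ⟨⟨hxU, hx⟩, ?_⟩, fun x hx => hx.1.2,
    ⟨hU', fun x hx => hs.subset hx.1.1, hs.continuousOn.mono fun x hx => hx.1.1,
      fun x hx => hs.injective x hx.1.1, fun x hx => hs.mem_iff x hx.1.1⟩,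
    hΦ.mono fun x hx => hx.1, continuousOn_inverse hC, ?_, ?_, ?_, hfin⟩
  · rw [hS]
    exact isUnit_one
  · intro x hx y
    exact DFunLike.congr_fun (Ring.mul_inverse_cancel _ hx.2) y
  · intro x hx y
    exact DFunLike.congr_fun (Ring.inverse_mul_cancel _ hx.2) y
  · exact fun y => DFunLike.congr_fun hS y

/-- The spaces `E(L, V)` form a subbundle. -/
theorem exists_finiteDimSubbundle_comap [CompleteSpace E₀] [CompleteSpace F₀]
    {L : ∀ x, E x →L[𝕜] F x} (hL : IsMorphism E₀ F₀ L)
    (hker : ∀ x, FiniteDimensional 𝕜 (L x).ker) {V : FiniteDimSubbundle 𝕜 F₀ F}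
    (hV : IsTransversal F₀ L V) :
    ∃ W : FiniteDimSubbundle 𝕜 E₀ E,
      ∀ x, W.space x = (V.space x).comap (L x : E x →ₗ[𝕜] F x) := by
  refine ⟨⟨fun x => (V.space x).comap (L x : E x →ₗ[𝕜] F x),
    isFiniteDimBundle_of_isLocalFrame _ fun x₀ => ?_⟩, fun x => rfl⟩
  let e := trivializationAt E₀ E x₀
  let f := trivializationAt F₀ F x₀
  obtain ⟨n, U, s, S, A, hxU, hUe, hs, hΦ, hA, hr, hl, h0, hfin⟩ :=
    exists_local_rightInverse hL hker hV e f (mem_baseSet_trivializationAt E₀ E x₀)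
      (mem_baseSet_trivializationAt F₀ F x₀)
  let Φ : X → E₀ × (Fin n → 𝕜) →L[𝕜] F₀ := fun x => augmented (localRep e f L x) (s x)
  -- Since `S ∘ A x` is a right inverse of `Φ x`, this is the projection onto `ker Φ x` along the
  -- range of `S`, a complement that does not vary with `x`. Hence it maps `ker Φ x₀` isomorphically
  -- onto `ker Φ x`.
  let Q : X → E₀ × (Fin n → 𝕜) →L[𝕜] E₀ × (Fin n → 𝕜) := fun x => .id 𝕜 _ - S ∘L A x ∘L Φ x
  have hQ : ∀ x z, Q x z = z - S (A x (Φ x z)) := fun x z => rfl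
  have hΦQ : ∀ x ∈ U, ∀ z, Φ x (Q x z) = 0 := fun x hx z => by
    rw [hQ, map_sub, sub_eq_zero]
    exact (hr x hx _).symm
  have key : IsLocalFrame (fun x => (V.space x).comap (L x : E x →ₗ[𝕜] F x)) e (H := (Φ x₀).ker) U
      fun x => ContinuousLinearMap.fst 𝕜 E₀ (Fin n → 𝕜) ∘L Q x ∘L (Φ x₀).ker.subtypeL := by
    refine ⟨hs.isOpen, hUe, ?_, ?_, ?_⟩
    · exact continuousOn_const.clm_comp ((continuousOn_const.sub
        (continuousOn_const.clm_comp (hA.clm_comp hΦ))).clm_comp continuousOn_const)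
    · intro x hx
      rw [injective_iff_map_eq_zero]
      rintro ⟨k, hk⟩ h
      have h1 : (Q x k).1 = 0 := h
      have h2 : localRep e f L x (Q x k).1 + s x (Q x k).2 = 0 := hΦQ x hx k
      rw [h1, map_zero, zero_add] at h2
      -- A vector of `ker Φ x` is determined by its first component because `s x` is injective. So
      -- `Q x k = 0`, that is, `k` lies in the range of `S`, which meets `ker Φ x₀` trivially.
      have h3 : (Q x k).2 = 0 := hs.injective x hx (by rw [h2, map_zero])
      have h4 : k - S (A x (Φ x k)) = 0 := Prod.ext h1 h3
      rw [sub_eq_zero] at h4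
      have h5 : Φ x₀ k = 0 := hk
      rw [h4] at h5
      have h6 : A x (Φ x k) = 0 := (h0 _).symm.trans h5
      rw [h6, map_zero] at h4
      exact Subtype.ext h4
    · intro x hx v
      rw [Submodule.mem_comap]
      refine (hs.mem_iff x hx (L x v)).trans ?_
      rw [← localRep_apply e f L (hUe hx)]
      constructor
      · rintro ⟨c, hc⟩
        let z : E₀ × (Fin n → 𝕜) := (e.continuousLinearMapAt 𝕜 x v, -c)
        have hz : Φ x z = 0 := by
          change localRep e f L x (e.continuousLinearMapAt 𝕜 x v) + s x (-c) = 0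
          rw [map_neg, hc, add_neg_cancel]
        -- Project `z` to `ker Φ x₀` along the range of `S`. The correction is killed by `Q x`,
        -- while `Q x` fixes `z`.
        refine ⟨⟨z - S (Φ x₀ z), ?_⟩, ?_⟩
        · change Φ x₀ (z - S (Φ x₀ z)) = 0
          rw [map_sub, sub_eq_zero]
          exact (h0 _).symm
        · change (Q x (z - S (Φ x₀ z))).1 = z.1
          have h1 : A x (Φ x (S (Φ x₀ z))) = Φ x₀ z := hl x hx _
          rw [map_sub, hQ, hQ, hz, h1]
          simp
      · rintro ⟨k, hk⟩
        have hk' : (Q x k).1 = e.continuousLinearMapAt 𝕜 x v := hk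
        refine ⟨-(Q x k).2, ?_⟩
        have h2 : localRep e f L x (Q x k).1 + s x (Q x k).2 = 0 := hΦQ x hx k
        rw [map_neg, ← hk', eq_comm]
        exact eq_neg_of_add_eq_zero_left h2
  have : FiniteDimensional 𝕜 (Φ x₀).ker := hfin
  obtain ⟨m, w, hw⟩ := key.exists_fin
  exact ⟨m, e, inferInstance, U, w, hxU, hw⟩

variable [∀ x, IsTopologicalAddGroup (E x)] [∀ x, ContinuousSMul 𝕜 (E x)]

theorem exists_local_parametrix [CompleteSpace E₀] [CompleteSpace F₀]
    {L : ∀ x, E x →L[𝕜] F x} (hL : IsMorphism E₀ F₀ L)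
    (hker : ∀ x, FiniteDimensional 𝕜 (L x).ker) {V : FiniteDimSubbundle 𝕜 F₀ F}
    (hV : IsTransversal F₀ L V) (x₀ : X) :
    ∃ (U : Set X) (σ : ∀ x, F x →L[𝕜] E x), IsOpen U ∧ x₀ ∈ U ∧
      (∀ x ∈ U, ContinuousAt (fun x => TotalSpace.mk' (F₀ →L[𝕜] E₀)
        (E := fun x => F x →L[𝕜] E x) x (σ x)) x) ∧
      ∀ x ∈ U, ∀ v, L x (σ x v) - v ∈ V.space x := by
  let e := trivializationAt E₀ E x₀
  let f := trivializationAt F₀ F x₀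
  obtain ⟨n, U, s, S, A, hxU, hUe, hs, hΦ, hA, hr, hl, h0, hfin⟩ :=
    exists_local_rightInverse hL hker hV e f (mem_baseSet_trivializationAt E₀ E x₀)
      (mem_baseSet_trivializationAt F₀ F x₀)
  let P : X → F₀ →L[𝕜] E₀ := fun x => ContinuousLinearMap.fst 𝕜 E₀ (Fin n → 𝕜) ∘L S ∘L A x
  have hP : ContinuousOn P U :=
    continuousOn_const.clm_comp (continuousOn_const.clm_comp hA)
  refine ⟨U, fun x => e.symmL 𝕜 x ∘L P x ∘L f.continuousLinearMapAt 𝕜 x, hs.isOpen, hxU, ?_, ?_⟩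
  · intro x hx
    rw [continuousAt_hom_section_iff 𝕜 (b := fun x => x) f e (hs.subset hx) (hUe hx)]
    refine ⟨continuousAt_id, (hP.continuousAt (hs.isOpen.mem_nhds hx)).congr ?_⟩
    filter_upwards [hs.isOpen.mem_nhds hx] with z hz
    ext y
    simp only [ContinuousLinearMap.comp_apply]
    rw [e.continuousLinearMapAt_symmL (hUe hz), f.continuousLinearMapAt_symmL (hs.subset hz)]
  · intro x hx v
    rw [hs.mem_iff x hx]
    -- If `(u, c)` is the chosen solution of `L u + s c = v`, then `L u - v = -s c` lies in `V`.
    refine ⟨-(S (A x (f.continuousLinearMapAt 𝕜 x v))).2, ?_⟩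
    have h1 : localRep e f L x (S (A x (f.continuousLinearMapAt 𝕜 x v))).1 +
      s x (S (A x (f.continuousLinearMapAt 𝕜 x v))).2 = f.continuousLinearMapAt 𝕜 x v := hr x hx _
    have h2 : localRep e f L x (S (A x (f.continuousLinearMapAt 𝕜 x v))).1 =
      f.continuousLinearMapAt 𝕜 x (L x ((e.symmL 𝕜 x ∘L P x ∘L f.continuousLinearMapAt 𝕜 x) v)) :=
      rfl
    rw [map_sub, ← h2, map_neg]
    nth_rewrite 3 [← h1]
    abel

/-- A transversal subbundle gives rise to a global right parametrix. -/
theorem exists_parametrix [CompactSpace X] [T2Space X] [CompleteSpace E₀] [CompleteSpace F₀]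
    {L : ∀ x, E x →L[𝕜] F x} (hL : IsMorphism E₀ F₀ L)
    (hker : ∀ x, FiniteDimensional 𝕜 (L x).ker) {V : FiniteDimSubbundle 𝕜 F₀ F}
    (hV : IsTransversal F₀ L V) :
    ∃ σ : ∀ x, F x →L[𝕜] E x, IsMorphism F₀ E₀ σ ∧ ∀ x v, L x (σ x v) - v ∈ V.space x := by
  -- The condition `L σ - χ ∈ V` is additive in the pair `(σ, χ)`, so local parametrices cut off by
  -- bump functions can be summed; dividing by the total weight, which is positive everywhere,
  -- normalizes at the end.
  have key : ∃ (σ : ∀ x, F x →L[𝕜] E x) (χ : X → ℝ), IsMorphism F₀ E₀ σ ∧ Continuous χ ∧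
      (∀ x, 0 ≤ χ x) ∧ (∀ x ∈ (univ : Set X), 0 < χ x) ∧
      ∀ x v, L x (σ x v) - (χ x : 𝕜) • v ∈ V.space x := by
    refine isCompact_univ.induction_on (p := fun K => ∃ (σ : ∀ x, F x →L[𝕜] E x) (χ : X → ℝ),
      IsMorphism F₀ E₀ σ ∧ Continuous χ ∧ (∀ x, 0 ≤ χ x) ∧ (∀ x ∈ K, 0 < χ x) ∧
      ∀ x v, L x (σ x v) - (χ x : 𝕜) • v ∈ V.space x) ?_ ?_ ?_ ?_
    · refine ⟨fun x => 0, fun x => 0, Trivialization.continuous_zeroSection 𝕜, continuous_const,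
        fun x => le_rfl, fun x hx => hx.elim, fun x v => by simp⟩
    · rintro s t hst ⟨σ, χ, h1, h2, h3, h4, h5⟩
      exact ⟨σ, χ, h1, h2, h3, fun x hx => h4 x (hst hx), h5⟩
    · rintro s t ⟨σ, χ, h1, h2, h3, h4, h5⟩ ⟨σ', χ', h1', h2', h3', h4', h5'⟩
      refine ⟨fun x => σ x + σ' x, fun x => χ x + χ' x,
        continuous_section_add 𝕜 (b := fun x => x) h1 h1', h2.add h2',
        fun x => add_nonneg (h3 x) (h3' x), ?_, fun x v => ?_⟩
      · rintro x (hx | hx)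
        · exact add_pos_of_pos_of_nonneg (h4 x hx) (h3' x)
        · exact add_pos_of_nonneg_of_pos (h3 x) (h4' x hx)
      · convert (V.space x).add_mem (h5 x v) (h5' x v) using 1
        simp only [add_apply, map_add, add_smul]
        abel
    · intro x _
      obtain ⟨U, σ, hU, hxU, hσ, hσV⟩ := exists_local_parametrix hL hker hV x
      obtain ⟨K, χ, hK, -, -, hχ, hχ0, hχ1, hχU⟩ := exists_bump 𝕜 hU hxU
      refine ⟨K, mem_nhdsWithin_of_mem_nhds hK, fun x => (χ x : 𝕜) • σ x, χ,
        continuous_section_smul_of_tsupport_subset 𝕜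
          (RCLike.continuous_ofReal.comp hχ) hχU hσ, hχ, hχ0,
        fun y hy => by rw [hχ1 y hy]; exact one_pos, fun y v => ?_⟩
      have h1 : L y (((χ y : 𝕜) • σ y) v) - (χ y : 𝕜) • v = (χ y : 𝕜) • (L y (σ y v) - v) := by
        rw [smul_sub, smul_apply, map_smul]
      rw [h1]
      by_cases hy : y ∈ U
      · exact (V.space y).smul_mem _ (hσV y hy v)
      · have : (χ y : 𝕜) = 0 :=
          image_eq_zero_of_notMem_tsupport (f := fun x => (χ x : 𝕜)) fun h => hy (hχU h)
        rw [this, zero_smul]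
        exact (V.space y).zero_mem
  obtain ⟨σ, χ, h1, h2, h3, h4, h5⟩ := key
  have h6 : ∀ x, (χ x : 𝕜) ≠ 0 := fun x => by simpa using (h4 x (mem_univ x)).ne'
  refine ⟨fun x => (χ x : 𝕜)⁻¹ • σ x, continuous_section_smul (b := fun x => x)
    ((RCLike.continuous_ofReal.comp h2).inv₀ h6) h1, fun x v => ?_⟩
  convert (V.space x).smul_mem (χ x : 𝕜)⁻¹ (h5 x v) using 1
  rw [smul_sub, smul_apply, map_smul, inv_smul_smul₀ (h6 x)]

end LocalAnalysis

/-! ### Independence of the transversal subbundle -/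

theorem FiniteDimBundle.toK_eq_add {𝕜 : Type*} [RCLike 𝕜] {X : Type u} [TopologicalSpace X]
    {A B C : FiniteDimBundle.{u, v} 𝕜 X} (h : IsDirectSum A B C) : A.toK = B.toK + C.toK := by
  change (QuotientAddGroup.mk (FreeAbelianGroup.of A) : KGroup 𝕜 X) =
    QuotientAddGroup.mk (FreeAbelianGroup.of B + FreeAbelianGroup.of C)
  rw [QuotientAddGroup.eq_iff_sub_mem]
  exact AddSubgroup.subset_closure ⟨A, B, C, h, rfl⟩

/-- The fibrewise direct sum of vector bundles. -/
def FiniteDimBundle.prod {𝕜 : Type*} [RCLike 𝕜] {X : Type u} [TopologicalSpace X]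
    (B C : FiniteDimBundle.{u, v} 𝕜 X) : FiniteDimBundle.{u, v} 𝕜 X :=
  letI : TopologicalSpace (TotalSpace Unit fun x => B.Fiber x × C.Fiber x) :=
    TopologicalSpace.induced (fun p => ((⟨p.1, p.2.1⟩, ⟨p.1, p.2.2⟩) :
      TotalSpace Unit B.Fiber × TotalSpace Unit C.Fiber)) inferInstance
  { Fiber := fun x => B.Fiber x × C.Fiber x
    isFiniteDimBundle := isFiniteDimBundle_of_isInducing B.isFiniteDimBundle C.isFiniteDimBundle
      (fun _ => LinearEquiv.refl 𝕜 _) ⟨rfl⟩ }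

theorem FiniteDimBundle.isInducing_prod {𝕜 : Type*} [RCLike 𝕜] {X : Type u} [TopologicalSpace X]
    (B C : FiniteDimBundle.{u, v} 𝕜 X) :
    IsInducing (fun p : TotalSpace Unit (B.prod C).Fiber => ((⟨p.1, p.2.1⟩, ⟨p.1, p.2.2⟩) :
      TotalSpace Unit B.Fiber × TotalSpace Unit C.Fiber)) := ⟨rfl⟩

theorem FiniteDimBundle.isDirectSum_prod {𝕜 : Type*} [RCLike 𝕜] {X : Type u} [TopologicalSpace X]
    (B C : FiniteDimBundle.{u, v} 𝕜 X) : IsDirectSum (B.prod C) B C :=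
  ⟨fun _ => LinearEquiv.refl 𝕜 _, B.isInducing_prod C⟩

theorem FiniteDimSubbundle.isInducing_subtype {𝕜 : Type*} [RCLike 𝕜] {X : Type u}
    [TopologicalSpace X] {F₀ : Type*} {F : X → Type v} [∀ x, AddCommGroup (F x)]
    [∀ x, Module 𝕜 (F x)] [TopologicalSpace (TotalSpace F₀ F)] (V : FiniteDimSubbundle 𝕜 F₀ F) :
    IsInducing fun p : TotalSpace Unit V.toBundle.Fiber =>
      (⟨p.1, (p.2 : V.space p.1).1⟩ : TotalSpace F₀ F) := ⟨rfl⟩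

/-! ### Linear algebra of the comparison of two transversal subspaces. -/

section Exchange

variable {R M N : Type*} [Ring R] [AddCommGroup M] [Module R M] [AddCommGroup N] [Module R N]
  {V₁ V₂ : Submodule R N} {W₁ W₂ : Submodule R M}

/-- For a linear map `L : M → N` with sections `σ` and `τ` modulo `V₁` and `V₂`: the comparison of
`L⁻¹(V₁) × V₂` with `L⁻¹(V₂) × V₁`. -/
def exchange (L : M →ₗ[R] N) (σ τ : N →ₗ[R] M) (hW₁ : W₁ = V₁.comap L) (hW₂ : W₂ = V₂.comap L)
    (hσ : ∀ v, L (σ v) - v ∈ V₁) (hτ : ∀ v, L (τ v) - v ∈ V₂) : W₁ × V₂ →ₗ[R] W₂ × V₁ where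
  toFun p :=
    (⟨p.1 + σ p.2 - τ (L p.1 + L (σ p.2) - p.2), by
        subst hW₁ hW₂
        rw [Submodule.mem_comap]
        have := V₂.sub_mem p.2.2 (hτ (L p.1 + L (σ p.2) - p.2))
        convert this using 1
        simp only [map_add, map_sub]
        abel⟩,
      ⟨L p.1 + L (σ p.2) - p.2, by
        subst hW₁ hW₂
        rw [add_sub_assoc]
        exact V₁.add_mem p.1.2 (hσ _)⟩)
  map_add' p q := by
    refine Prod.ext (Subtype.ext ?_) (Subtype.ext ?_)
    · simp only [Prod.fst_add, Prod.snd_add, Submodule.coe_add, map_add, map_sub]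
      abel
    · simp only [Prod.fst_add, Prod.snd_add, Submodule.coe_add, map_add, map_sub]
      abel
  map_smul' c p := by
    refine Prod.ext (Subtype.ext ?_) (Subtype.ext ?_)
    · simp only [Prod.smul_fst, Prod.smul_snd, Submodule.coe_smul, map_smul, ← smul_add,
        ← smul_sub, RingHom.id_apply]
    · simp only [Prod.smul_fst, Prod.smul_snd, Submodule.coe_smul, map_smul, ← smul_add,
        ← smul_sub, RingHom.id_apply]

/-- Write `v' = L u + L (σ v) - v` and `u' = u + σ v - τ v'` for the image of `(u, v)`. Then `L u' +
L (τ v') - v' = v`, and therefore `u' + τ v' - σ v = u`: exchanging `σ` and `τ` inverts the map. -/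
theorem exchange_exchange (L : M →ₗ[R] N) (σ τ : N →ₗ[R] M) (hW₁ : W₁ = V₁.comap L)
    (hW₂ : W₂ = V₂.comap L) (hσ : ∀ v, L (σ v) - v ∈ V₁) (hτ : ∀ v, L (τ v) - v ∈ V₂)
    (p : W₁ × V₂) :
    exchange L τ σ hW₂ hW₁ hτ hσ (exchange L σ τ hW₁ hW₂ hσ hτ p) = p := by
  refine Prod.ext (Subtype.ext ?_) (Subtype.ext ?_)
  · simp only [exchange, LinearMap.coe_mk, AddHom.coe_mk, map_add, map_sub]
    abel
  · simp only [exchange, LinearMap.coe_mk, AddHom.coe_mk, map_add, map_sub]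
    abel

/-- The isomorphism `L⁻¹(V₁) × V₂ ≃ L⁻¹(V₂) × V₁`. -/
def exchangeEquiv (L : M →ₗ[R] N) (σ τ : N →ₗ[R] M) (hW₁ : W₁ = V₁.comap L)
    (hW₂ : W₂ = V₂.comap L) (hσ : ∀ v, L (σ v) - v ∈ V₁) (hτ : ∀ v, L (τ v) - v ∈ V₂) :
    (W₁ × V₂) ≃ₗ[R] W₂ × V₁ :=
  { exchange L σ τ hW₁ hW₂ hσ hτ with
    invFun := exchange L τ σ hW₂ hW₁ hτ hσ
    left_inv := exchange_exchange L σ τ hW₁ hW₂ hσ hτ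
    right_inv := exchange_exchange L τ σ hW₂ hW₁ hτ hσ }

end Exchange

section Independence

variable {𝕜 : Type*} [RCLike 𝕜] {X : Type u} [TopologicalSpace X]
  {E₀ : Type*} [NormedAddCommGroup E₀] [NormedSpace 𝕜 E₀]
  {E : X → Type v} [∀ x, AddCommGroup (E x)] [∀ x, Module 𝕜 (E x)] [∀ x, TopologicalSpace (E x)]
  [TopologicalSpace (TotalSpace E₀ E)] [FiberBundle E₀ E] [VectorBundle 𝕜 E₀ E]
  {F₀ : Type*} [NormedAddCommGroup F₀] [NormedSpace 𝕜 F₀]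
  {F : X → Type v} [∀ x, AddCommGroup (F x)] [∀ x, Module 𝕜 (F x)] [∀ x, TopologicalSpace (F x)]
  [∀ x, IsTopologicalAddGroup (F x)] [∀ x, ContinuousSMul 𝕜 (F x)]
  [TopologicalSpace (TotalSpace F₀ F)] [FiberBundle F₀ F] [VectorBundle 𝕜 F₀ F]

theorem IsMorphism.continuous_apply {L : ∀ x, E x →L[𝕜] F x} (hL : IsMorphism E₀ F₀ L)
    {Y : Type*} [TopologicalSpace Y] {b : Y → X} {u : ∀ y, E (b y)}
    (hu : Continuous fun y => TotalSpace.mk' E₀ (b y) (u y)) :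
    Continuous fun y => TotalSpace.mk' F₀ (b y) (L (b y) (u y)) :=
  Continuous.clm_bundle_apply
    (hL.comp ((FiberBundle.continuous_proj E₀ E).comp hu : Continuous b)) hu

variable [∀ x, IsTopologicalAddGroup (E x)] [∀ x, ContinuousSMul 𝕜 (E x)]

/-- The exchange formula makes sense on all of `E` and `F`. Allowing any topological space `Y` lets
it be applied to one set with two topologies, not yet known to agree. -/
theorem continuous_exchange {L : ∀ x, E x →L[𝕜] F x} (hL : IsMorphism E₀ F₀ L)
    {σ τ : ∀ x, F x →L[𝕜] E x} (hσ : IsMorphism F₀ E₀ σ) (hτ : IsMorphism F₀ E₀ τ)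
    {Y : Type*} [TopologicalSpace Y] {b : Y → X} {u : ∀ y, E (b y)} {v : ∀ y, F (b y)}
    (hu : Continuous fun y => TotalSpace.mk' E₀ (b y) (u y))
    (hv : Continuous fun y => TotalSpace.mk' F₀ (b y) (v y)) :
    Continuous fun y => (TotalSpace.mk' E₀ (b y)
      (u y + σ (b y) (v y) -
        τ (b y) (L (b y) (u y) + L (b y) (σ (b y) (v y)) - v y)),
      TotalSpace.mk' F₀ (b y) (L (b y) (u y) + L (b y) (σ (b y) (v y)) - v y)) := by
  have h1 := hσ.continuous_apply hv
  have h2 := continuous_section_sub 𝕜 (continuous_section_add 𝕜 (hL.continuous_apply hu)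
    (hL.continuous_apply h1)) hv
  exact (continuous_section_sub 𝕜 (continuous_section_add 𝕜 hu h1)
    (hτ.continuous_apply h2)).prodMk h2

theorem isDirectSum_exchange {L : ∀ x, E x →L[𝕜] F x} (hL : IsMorphism E₀ F₀ L)
    {σ τ : ∀ x, F x →L[𝕜] E x} (hσ : IsMorphism F₀ E₀ σ) (hτ : IsMorphism F₀ E₀ τ)
    {V₁ V₂ : FiniteDimSubbundle 𝕜 F₀ F} {W₁ W₂ : FiniteDimSubbundle 𝕜 E₀ E}
    (hσV : ∀ x v, L x (σ x v) - v ∈ V₁.space x) (hτV : ∀ x v, L x (τ x v) - v ∈ V₂.space x)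
    (hW₁ : ∀ x, W₁.space x = (V₁.space x).comap (L x : E x →ₗ[𝕜] F x))
    (hW₂ : ∀ x, W₂.space x = (V₂.space x).comap (L x : E x →ₗ[𝕜] F x)) :
    IsDirectSum (W₁.toBundle.prod V₂.toBundle) W₂.toBundle V₁.toBundle := by
  let φ : ∀ x, (W₁.space x × V₂.space x) ≃ₗ[𝕜] W₂.space x × V₁.space x := fun x =>
    exchangeEquiv (L x : E x →ₗ[𝕜] F x) (σ x : F x →ₗ[𝕜] E x) (τ x : F x →ₗ[𝕜] E x)
      (hW₁ x) (hW₂ x) (hσV x) (hτV x)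
  refine ⟨φ, ?_⟩
  let Z := TotalSpace Unit (W₁.toBundle.prod V₂.toBundle).Fiber
  let u : ∀ p : Z, E p.1 := fun p => Subtype.val (p := (· ∈ W₁.space p.1)) p.2.1
  let v : ∀ p : Z, F p.1 := fun p => Subtype.val (p := (· ∈ V₂.space p.1)) p.2.2
  let u' : ∀ p : Z, E p.1 := fun p => (φ p.1 p.2).1
  let v' : ∀ p : Z, F p.1 := fun p => (φ p.1 p.2).2
  have h : IsInducing fun p : Z => (TotalSpace.mk' E₀ p.1 (u p), TotalSpace.mk' F₀ p.1 (v p)) :=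
    (W₁.isInducing_subtype.prodMap V₂.isInducing_subtype).comp
      (FiniteDimBundle.isInducing_prod _ _)
  have h' : IsInducing fun p : Z =>
      (TotalSpace.mk' E₀ p.1 (u' p), TotalSpace.mk' F₀ p.1 (v' p)) := by
    -- The topology on `Z` is the one induced by `(u, v)`. It agrees with the one induced by `(u',
    -- v')` because each pair is a continuous function of the other, through the exchange map and
    -- its inverse.
    refine ⟨le_antisymm ?_ ?_⟩
    · rw [← continuous_iff_le_induced]
      exact continuous_exchange hL hσ hτ (b := fun p : Z => p.1) (u := u) (v := v)
        (continuous_fst.comp h.continuous) (continuous_snd.comp h.continuous)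
    · rw [h.eq_induced, ← continuous_iff_le_induced]
      let t : TopologicalSpace Z := TopologicalSpace.induced
        (fun p : Z => (TotalSpace.mk' E₀ p.1 (u' p), TotalSpace.mk' F₀ p.1 (v' p))) inferInstance
      have hc : @Continuous Z _ t _ fun p : Z =>
        (TotalSpace.mk' E₀ p.1 (u' p), TotalSpace.mk' F₀ p.1 (v' p)) := continuous_induced_dom
      have h2 := @continuous_exchange 𝕜 _ X _ E₀ _ _ E _ _ _ _ _ _ F₀ _ _ F _ _ _ _ _ _ _ _ _ _
        L hL τ σ hτ hσ Z t (fun p : Z => p.1) u' v'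
        (@Continuous.comp _ _ _ t _ _ _ _ continuous_fst hc)
        (@Continuous.comp _ _ _ t _ _ _ _ continuous_snd hc)
      convert h2 using 1
      funext p
      have h3 := (φ p.1).symm_apply_apply p.2
      have h4 : u p = (((φ p.1).symm (φ p.1 p.2)).1 : E p.1) := by rw [h3]
      have h5 : v p = (((φ p.1).symm (φ p.1 p.2)).2 : F p.1) := by rw [h3]
      rw [h4, h5]
      rfl
  exact (IsInducing.of_comp_iff (W₂.isInducing_subtype.prodMap V₁.isInducing_subtype)).1 h'

theorem toK_sub_toK_eq [CompactSpace X] [T2Space X] [CompleteSpace E₀] [CompleteSpace F₀]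
    {L : ∀ x, E x →L[𝕜] F x} (hL : IsMorphism E₀ F₀ L)
    (hker : ∀ x, FiniteDimensional 𝕜 (L x).ker)
    {V₁ V₂ : FiniteDimSubbundle 𝕜 F₀ F} {W₁ W₂ : FiniteDimSubbundle 𝕜 E₀ E}
    (hV₁ : IsTransversal F₀ L V₁) (hV₂ : IsTransversal F₀ L V₂)
    (hW₁ : ∀ x, W₁.space x = (V₁.space x).comap (L x : E x →ₗ[𝕜] F x))
    (hW₂ : ∀ x, W₂.space x = (V₂.space x).comap (L x : E x →ₗ[𝕜] F x)) :
    W₁.toBundle.toK - V₁.toBundle.toK = W₂.toBundle.toK - V₂.toBundle.toK := by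
  obtain ⟨σ, hσ, hσV⟩ := exists_parametrix hL hker hV₁
  obtain ⟨τ, hτ, hτV⟩ := exists_parametrix hL hker hV₂
  have h1 := FiniteDimBundle.toK_eq_add (isDirectSum_exchange hL hσ hτ hσV hτV hW₁ hW₂)
  rw [FiniteDimBundle.toK_eq_add (FiniteDimBundle.isDirectSum_prod _ _)] at h1
  rw [sub_eq_sub_iff_add_eq_add, h1]

end Independence

/-! ### Existence of transversal subbundles -/

section Existence

variable {𝕜 : Type*} [RCLike 𝕜] {X : Type u} [TopologicalSpace X]
  {E₀ : Type*} [NormedAddCommGroup E₀] [NormedSpace 𝕜 E₀]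
  {E : X → Type v} [∀ x, AddCommGroup (E x)] [∀ x, Module 𝕜 (E x)] [∀ x, TopologicalSpace (E x)]
  [TopologicalSpace (TotalSpace E₀ E)] [FiberBundle E₀ E] [VectorBundle 𝕜 E₀ E]
  {F₀ : Type*} [NormedAddCommGroup F₀] [NormedSpace 𝕜 F₀]
  {F : X → Type v} [∀ x, AddCommGroup (F x)] [∀ x, Module 𝕜 (F x)] [∀ x, TopologicalSpace (F x)]
  [TopologicalSpace (TotalSpace F₀ F)] [FiberBundle F₀ F] [VectorBundle 𝕜 F₀ F]
  {ι : Type} [Fintype ι]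

/-- Turns transversality of finitely many vectors into surjectivity of a bounded operator between
fixed spaces, which is an open condition. -/
theorem augmented_combination_surjective_iff (e : Trivialization E₀ (π E₀ E))
    [MemTrivializationAtlas e] (f : Trivialization F₀ (π F₀ F)) [MemTrivializationAtlas f]
    (L : ∀ x, E x →L[𝕜] F x) {x : X} (hx : x ∈ e.baseSet) (hx' : x ∈ f.baseSet) (t : ι → F x) :
    Function.Surjective (augmented (localRep e f L x)
      (combination fun i => f.continuousLinearMapAt 𝕜 x (t i))) ↔
        (L x).range ⊔ Submodule.span 𝕜 (range t) = ⊤ := by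
  have key : ∀ u c, augmented (localRep e f L x)
      (combination fun i => f.continuousLinearMapAt 𝕜 x (t i))
        (e.continuousLinearMapAt 𝕜 x u, c) =
      f.continuousLinearMapAt 𝕜 x (L x u + ∑ i, c i • t i) := by
    intro u c
    rw [augmented_apply, localRep_apply e f L hx, combination_apply, map_add, map_sum]
    simp only [map_smul]
  constructor
  · intro h
    rw [eq_top_iff]
    intro v _
    obtain ⟨⟨u, c⟩, huc⟩ := h (f.continuousLinearMapAt 𝕜 x v)
    rw [← e.continuousLinearMapAt_symmL (R := 𝕜) hx u, key] at huc
    have h2 := congrArg (f.symmL 𝕜 x) huc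
    rw [f.symmL_continuousLinearMapAt hx', f.symmL_continuousLinearMapAt hx'] at h2
    rw [← h2]
    exact Submodule.add_mem_sup ⟨_, rfl⟩
      ((Submodule.mem_span_range_iff_exists_fun 𝕜).2 ⟨c, rfl⟩)
  · intro h y
    obtain ⟨_, ⟨u, rfl⟩, v, hv, huv⟩ := Submodule.mem_sup.1
      (h ▸ Submodule.mem_top : f.symmL 𝕜 x y ∈ (L x).range ⊔ Submodule.span 𝕜 (range t))
    obtain ⟨c, rfl⟩ := (Submodule.mem_span_range_iff_exists_fun 𝕜).1 hv
    refine ⟨(e.continuousLinearMapAt 𝕜 x u, c), ?_⟩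
    rw [key]
    exact (congrArg _ huv).trans (f.continuousLinearMapAt_symmL hx' y)

theorem linearIndependent_continuousLinearMapAt_iff (f : Trivialization F₀ (π F₀ F))
    [MemTrivializationAtlas f] {x : X} (hx : x ∈ f.baseSet) {κ : Type*} (t : κ → F x) :
    LinearIndependent 𝕜 (fun i => f.continuousLinearMapAt 𝕜 x (t i)) ↔ LinearIndependent 𝕜 t := by
  refine LinearMap.linearIndependent_iff (f.continuousLinearMapAt 𝕜 x).toLinearMap ?_
  refine LinearMap.ker_eq_bot.2 fun a b hab => ?_
  have h2 := congrArg (f.symmL 𝕜 x) hab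
  simpa only [ContinuousLinearMap.coe_coe, f.symmL_continuousLinearMapAt hx] using h2

theorem eventually_linearIndependent {Y : Type*} [TopologicalSpace Y] {b : Y → X}
    {t : ι → ∀ y, F (b y)} {y₀ : Y}
    (ht : ∀ i, Continuous fun y => TotalSpace.mk' F₀ (b y) (t i y)) (hb : Continuous b)
    (h : LinearIndependent 𝕜 fun i => t i y₀) :
    ∀ᶠ y in 𝓝 y₀, LinearIndependent 𝕜 fun i => t i y := by
  let f := trivializationAt F₀ F (b y₀)
  have hf := mem_baseSet_trivializationAt F₀ F (b y₀)
  have h1 : ContinuousAt (fun y i => f.continuousLinearMapAt 𝕜 (b y) (t i y)) y₀ :=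
    continuousAt_pi.2 fun i => ((continuousAt_section_iff 𝕜 f hf).1 (ht i).continuousAt).2
  have h2 := h1.preimage_mem_nhds (isOpen_setOfPred_linearIndependent.mem_nhds
    ((linearIndependent_continuousLinearMapAt_iff f hf fun i => t i y₀).2 h))
  filter_upwards [h2, hb.continuousAt.preimage_mem_nhds (f.open_baseSet.mem_nhds hf)] with y hy hy'
  exact (linearIndependent_continuousLinearMapAt_iff f hy' fun i => t i y).1 hy

theorem isFiniteDimBundle_span {s : ι → ∀ x, F x}
    (hs : ∀ i, Continuous fun x => TotalSpace.mk' F₀ x (s i x))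
    (h : ∀ x, LinearIndependent 𝕜 fun i => s i x) :
    letI := subspaceTopology 𝕜 F₀ F fun x => Submodule.span 𝕜 (range fun i => s i x)
    IsFiniteDimBundle 𝕜 fun x => Submodule.span 𝕜 (range fun i => s i x) := by
  refine isFiniteDimBundle_of_isLocalFrame _ fun x₀ => ?_
  let f := trivializationAt F₀ F x₀
  have hf := mem_baseSet_trivializationAt F₀ F x₀
  have key : IsLocalFrame (fun x => Submodule.span 𝕜 (range fun i => s i x)) f f.baseSet
      fun x => combination (𝕜 := 𝕜) fun i => f.continuousLinearMapAt 𝕜 x (s i x) := by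
    refine ⟨f.open_baseSet, subset_rfl, ?_, ?_, ?_⟩
    · intro x hx
      refine ContinuousAt.continuousWithinAt (continuous_combination.continuousAt.comp
        (continuousAt_pi.2 fun i => ?_))
      exact ((continuousAt_section_iff 𝕜 (b := fun x => x) f hx).1 (hs i).continuousAt).2
    · intro x hx
      exact combination_injective
        ((linearIndependent_continuousLinearMapAt_iff f hx fun i => s i x).2 (h x))
    · intro x hx v
      rw [Submodule.mem_span_range_iff_exists_fun]
      refine exists_congr fun c => ?_
      have h1 : combination (fun i => f.continuousLinearMapAt 𝕜 x (s i x)) c =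
          f.continuousLinearMapAt 𝕜 x (∑ i, c i • s i x) := by
        rw [combination_apply, map_sum]
        simp only [map_smul]
      rw [h1]
      constructor
      · rintro rfl
        rfl
      · intro h2
        have h3 := congrArg (f.symmL 𝕜 x) h2
        rwa [f.symmL_continuousLinearMapAt hx, f.symmL_continuousLinearMapAt hx] at h3
  obtain ⟨m, w, hw⟩ := key.exists_fin
  exact ⟨m, f, inferInstance, _, w, hf, hw⟩

theorem isFiniteDimBundle_top [FiniteDimensional 𝕜 F₀] :
    letI := subspaceTopology 𝕜 F₀ F fun _ => (⊤ : Submodule 𝕜 _)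
    IsFiniteDimBundle 𝕜 fun x => (⊤ : Submodule 𝕜 (F x)) := by
  refine isFiniteDimBundle_of_isLocalFrame _ fun x₀ => ?_
  let f := trivializationAt F₀ F x₀
  have key : IsLocalFrame (fun x => (⊤ : Submodule 𝕜 (F x))) f f.baseSet
      fun x => ContinuousLinearMap.id 𝕜 F₀ :=
    ⟨f.open_baseSet, subset_rfl, continuousOn_const, fun _ _ => Function.injective_id,
      fun x _ v => ⟨fun _ => ⟨_, rfl⟩, fun _ => Submodule.mem_top⟩⟩
  obtain ⟨m, w, hw⟩ := key.exists_fin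
  exact ⟨m, f, inferInstance, _, w, mem_baseSet_trivializationAt F₀ F x₀, hw⟩

/-- Locally, the sections `s i` can be perturbed in order to become linearly independent. -/
theorem exists_perturbation [CompactSpace X] [T2Space X] [CompleteSpace F₀]
    (hF₀ : ¬ FiniteDimensional 𝕜 F₀) (x₀ : X) :
    ∃ K ∈ 𝓝 x₀, IsClosed K ∧ ∀ s : ι → ∀ x, F x,
      (∀ i, Continuous fun x => TotalSpace.mk' F₀ x (s i x)) →
      ∃ p : ι → ∀ x, F x, (∀ i, Continuous fun x => TotalSpace.mk' F₀ x (p i x)) ∧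
        ∀ x ∈ K, ∀ c : 𝕜, c ≠ 0 → LinearIndependent 𝕜 fun i => s i x + c • p i x := by
  let f := trivializationAt F₀ F x₀
  obtain ⟨K, χ, hK, hKc, hKU, hχ, -, hχ1, hχU⟩ := exists_bump 𝕜 f.open_baseSet
    (mem_baseSet_trivializationAt F₀ F x₀)
  refine ⟨K, hK, hKc, fun s hs => ?_⟩
  -- All values taken over `K`, read in the trivialization, form a compact set; the `a i` are chosen
  -- independent modulo its span.
  have hcomp : IsCompact (⋃ i, (fun x => f.continuousLinearMapAt 𝕜 x (s i x)) '' K) :=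
    isCompact_iUnion fun i => hKc.isCompact.image_of_continuousOn fun x hx =>
      ((continuousAt_section_iff 𝕜 (b := fun x => x) f (hKU hx)).1
        (hs i).continuousAt).2.continuousWithinAt
  obtain ⟨a, ha⟩ := exists_linearIndependent_mkQ_span hF₀ hcomp ι
  refine ⟨fun i x => (χ x : 𝕜) • f.symmL 𝕜 x (a i), fun i =>
    continuous_section_smul_of_tsupport_subset 𝕜 (RCLike.continuous_ofReal.comp hχ) hχU
      fun x hx => continuousAt_symmL f continuousAt_const hx, fun x hx c hc => ?_⟩
  rw [← linearIndependent_continuousLinearMapAt_iff f (hKU hx)]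
  refine LinearIndependent.of_comp
    (Submodule.span 𝕜 (⋃ i, (fun x => f.continuousLinearMapAt 𝕜 x (s i x)) '' K)).mkQ ?_
  -- Modulo that span the sections vanish, and `χ = 1` on `K`, so only the classes of `c • a i`
  -- remain; they are independent for every `c ≠ 0`, however small.
  have h1 := ha.units_smul fun _ => Units.mk0 c hc
  convert h1 using 1
  funext i
  have h2 : f.continuousLinearMapAt 𝕜 x (s i x) ∈
      Submodule.span 𝕜 (⋃ i, (fun x => f.continuousLinearMapAt 𝕜 x (s i x)) '' K) :=
    Submodule.subset_span (mem_iUnion.2 ⟨i, x, hx, rfl⟩)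
  simp only [Function.comp_apply, map_add, map_smul, hχ1 x hx, RCLike.ofReal_one, one_smul,
    f.continuousLinearMapAt_symmL (hKU hx)]
  rw [show (Submodule.span 𝕜 (⋃ i, (fun x => f.continuousLinearMapAt 𝕜 x (s i x)) '' K)).mkQ
    (f.continuousLinearMapAt 𝕜 x (s i x)) = 0 from (Submodule.Quotient.mk_eq_zero _).2 h2, zero_add]
  rfl

variable [∀ x, IsTopologicalAddGroup (F x)] [∀ x, ContinuousSMul 𝕜 (F x)]

theorem eventually_sup_span_eq_top [CompleteSpace E₀] [CompleteSpace F₀]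
    {L : ∀ x, E x →L[𝕜] F x} (hL : IsMorphism E₀ F₀ L)
    (hker : ∀ x, FiniteDimensional 𝕜 (L x).ker)
    {Y : Type*} [TopologicalSpace Y] {b : Y → X} {t : ι → ∀ y, F (b y)} {y₀ : Y}
    (ht : ∀ i, Continuous fun y => TotalSpace.mk' F₀ (b y) (t i y)) (hb : Continuous b)
    (h : (L (b y₀)).range ⊔ Submodule.span 𝕜 (range fun i => t i y₀) = ⊤) :
    ∀ᶠ y in 𝓝 y₀, (L (b y)).range ⊔ Submodule.span 𝕜 (range fun i => t i y) = ⊤ := by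
  let e := trivializationAt E₀ E (b y₀)
  have he := mem_baseSet_trivializationAt E₀ E (b y₀)
  let f := trivializationAt F₀ F (b y₀)
  have hf := mem_baseSet_trivializationAt F₀ F (b y₀)
  let Φ : Y → E₀ × (ι → 𝕜) →L[𝕜] F₀ := fun y => augmented (localRep e f L (b y))
    (combination fun i => f.continuousLinearMapAt 𝕜 (b y) (t i y))
  have h1 : ContinuousAt (fun y i => f.continuousLinearMapAt 𝕜 (b y) (t i y)) y₀ :=
    continuousAt_pi.2 fun i => ((continuousAt_section_iff 𝕜 f hf).1 (ht i).continuousAt).2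
  have h2 : ContinuousAt (fun y => combination (𝕜 := 𝕜) fun i =>
      f.continuousLinearMapAt 𝕜 (b y) (t i y)) y₀ :=
    continuous_combination.continuousAt.comp h1
  have h3 : ContinuousAt (fun y => localRep e f L (b y)) y₀ :=
    (hL.continuousAt_localRep e f he hf).comp hb.continuousAt
  have hΦ : ContinuousAt Φ y₀ :=
    (h3.clm_comp continuousAt_const).add (h2.clm_comp continuousAt_const)
  have h4 : Function.Surjective (Φ y₀) :=
    (augmented_combination_surjective_iff e f L he hf fun i => t i y₀).2 h
  have h5 : FiniteDimensional 𝕜 (Φ y₀).ker :=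
    finiteDimensional_ker_augmented (finiteDimensional_ker_localRep e f L he hf (hker _)) _
  filter_upwards [hΦ.eventually (eventually_surjective h4 h5),
    hb.continuousAt.preimage_mem_nhds (e.open_baseSet.mem_nhds he),
    hb.continuousAt.preimage_mem_nhds (f.open_baseSet.mem_nhds hf)] with y hy hy1 hy2
  exact (augmented_combination_surjective_iff e f L hy1 hy2 fun i => t i y).1 hy

/-- There are finitely many sections which, together with the image of `L`, span all fibres. -/
theorem exists_sections_sup_span_eq_top [CompactSpace X] [T2Space X] [CompleteSpace E₀]
    [CompleteSpace F₀] {L : ∀ x, E x →L[𝕜] F x} (hL : IsMorphism E₀ F₀ L)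
    (hker : ∀ x, FiniteDimensional 𝕜 (L x).ker) (hcoker : ∀ x, (L x).range.CoFG) :
    ∃ (ι : Type) (_ : Fintype ι) (s : ι → ∀ x, F x),
      (∀ i, Continuous fun x => TotalSpace.mk' F₀ x (s i x)) ∧
      ∀ x ∈ (univ : Set X), (L x).range ⊔ Submodule.span 𝕜 (range fun i => s i x) = ⊤ := by
  refine isCompact_univ.induction_on (p := fun K => ∃ (ι : Type) (_ : Fintype ι)
    (s : ι → ∀ x, F x), (∀ i, Continuous fun x => TotalSpace.mk' F₀ x (s i x)) ∧
      ∀ x ∈ K, (L x).range ⊔ Submodule.span 𝕜 (range fun i => s i x) = ⊤) ?_ ?_ ?_ ?_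
  · exact ⟨Empty, inferInstance, fun i => i.elim, fun i => i.elim, fun x hx => hx.elim⟩
  · rintro s t hst ⟨ι, _, a, h1, h2⟩
    exact ⟨ι, inferInstance, a, h1, fun x hx => h2 x (hst hx)⟩
  · rintro s t ⟨ι, _, a, h1, h2⟩ ⟨ι', _, a', h1', h2'⟩
    refine ⟨ι ⊕ ι', inferInstance, Sum.elim a a', fun i => ?_, fun x hx => ?_⟩
    · rcases i with i | i
      · exact h1 i
      · exact h1' i
    · rw [eq_top_iff]
      rcases hx with hx | hx
      · rw [← h2 x hx]
        refine sup_le_sup_left (Submodule.span_mono ?_) _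
        rintro _ ⟨i, rfl⟩
        exact ⟨Sum.inl i, rfl⟩
      · rw [← h2' x hx]
        refine sup_le_sup_left (Submodule.span_mono ?_) _
        rintro _ ⟨i, rfl⟩
        exact ⟨Sum.inr i, rfl⟩
  · intro x₀ _
    let f := trivializationAt F₀ F x₀
    have hf := mem_baseSet_trivializationAt F₀ F x₀
    obtain ⟨K, χ, hK, hKc, hKU, hχ, -, hχ1, hχU⟩ := exists_bump 𝕜 f.open_baseSet hf
    have : Module.Finite 𝕜 (F x₀ ⧸ (L x₀).range) := hcoker x₀
    obtain ⟨n, q, hq⟩ := Module.Finite.exists_fin (R := 𝕜) (M := F x₀ ⧸ (L x₀).range)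
    choose c hc using fun i => Submodule.mkQ_surjective (L x₀).range (q i)
    have hs : ∀ i : Fin n, Continuous fun x => TotalSpace.mk' F₀ x
        ((χ x : 𝕜) • f.symmL 𝕜 x (f.continuousLinearMapAt 𝕜 x₀ (c i))) := fun i =>
      continuous_section_smul_of_tsupport_subset 𝕜 (RCLike.continuous_ofReal.comp hχ) hχU
        fun x hx => continuousAt_symmL f continuousAt_const hx
    -- At `x₀` the cut-off constant sections take the values `c i`, which represent generators of
    -- the cokernel; transversality then persists nearby.
    have h0 : (L x₀).range ⊔ Submodule.span 𝕜 (range fun i : Fin n =>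
        (χ x₀ : 𝕜) • f.symmL 𝕜 x₀ (f.continuousLinearMapAt 𝕜 x₀ (c i))) = ⊤ := by
      have h1 : (fun i : Fin n =>
          (χ x₀ : 𝕜) • f.symmL 𝕜 x₀ (f.continuousLinearMapAt 𝕜 x₀ (c i))) = c := by
        funext i
        rw [hχ1 x₀ (mem_of_mem_nhds hK), f.symmL_continuousLinearMapAt hf]
        simp
      have h2 : Submodule.map (L x₀).range.mkQ (Submodule.span 𝕜 (range c)) = ⊤ := by
        rw [Submodule.map_span, ← range_comp, ← hq]
        exact congrArg (fun g => Submodule.span 𝕜 (range g)) (funext hc)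
      rw [h1, ← Submodule.comap_map_mkQ, h2, Submodule.comap_top]
    refine ⟨_, mem_nhdsWithin_of_mem_nhds (eventually_sup_span_eq_top hL hker
      (b := fun x => x) hs continuous_id h0), Fin n, inferInstance, _, hs, fun x hx => hx⟩

/-- General position: independence is achieved on one closed piece of a finite cover at a time, by
perturbations small enough to preserve transversality and the independence already gained. -/
theorem exists_linearIndependent_sections [CompactSpace X] [T2Space X] [CompleteSpace E₀]
    [CompleteSpace F₀] {L : ∀ x, E x →L[𝕜] F x} (hL : IsMorphism E₀ F₀ L)
    (hker : ∀ x, FiniteDimensional 𝕜 (L x).ker) (hF₀ : ¬ FiniteDimensional 𝕜 F₀)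
    {s₀ : ι → ∀ x, F x} (hs₀ : ∀ i, Continuous fun x => TotalSpace.mk' F₀ x (s₀ i x))
    (hs₀' : ∀ x, (L x).range ⊔ Submodule.span 𝕜 (range fun i => s₀ i x) = ⊤) :
    ∃ s : ι → ∀ x, F x, (∀ i, Continuous fun x => TotalSpace.mk' F₀ x (s i x)) ∧
      (∀ x, (L x).range ⊔ Submodule.span 𝕜 (range fun i => s i x) = ⊤) ∧
      ∀ x, LinearIndependent 𝕜 fun i => s i x := by
  -- Quantifying over every closed `C` on which independence already holds makes the property stable
  -- under unions, so compactness induction applies. The closed superset `K'` supplies the next `C`.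
  have key : ∃ K' : Set X, univ ⊆ K' ∧ IsClosed K' ∧ ∀ C : Set X, IsClosed C →
      ∀ s : ι → ∀ x, F x, (∀ i, Continuous fun x => TotalSpace.mk' F₀ x (s i x)) →
      (∀ x, (L x).range ⊔ Submodule.span 𝕜 (range fun i => s i x) = ⊤) →
      (∀ x ∈ C, LinearIndependent 𝕜 fun i => s i x) →
      ∃ s' : ι → ∀ x, F x, (∀ i, Continuous fun x => TotalSpace.mk' F₀ x (s' i x)) ∧
        (∀ x, (L x).range ⊔ Submodule.span 𝕜 (range fun i => s' i x) = ⊤) ∧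
        ∀ x ∈ C ∪ K', LinearIndependent 𝕜 fun i => s' i x := by
    refine isCompact_univ.induction_on (p := fun K => ∃ K' : Set X, K ⊆ K' ∧ IsClosed K' ∧
      ∀ C : Set X, IsClosed C →
      ∀ s : ι → ∀ x, F x, (∀ i, Continuous fun x => TotalSpace.mk' F₀ x (s i x)) →
      (∀ x, (L x).range ⊔ Submodule.span 𝕜 (range fun i => s i x) = ⊤) →
      (∀ x ∈ C, LinearIndependent 𝕜 fun i => s i x) →
      ∃ s' : ι → ∀ x, F x, (∀ i, Continuous fun x => TotalSpace.mk' F₀ x (s' i x)) ∧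
        (∀ x, (L x).range ⊔ Submodule.span 𝕜 (range fun i => s' i x) = ⊤) ∧
        ∀ x ∈ C ∪ K', LinearIndependent 𝕜 fun i => s' i x) ?_ ?_ ?_ ?_
    · refine ⟨∅, subset_rfl, isClosed_empty, fun C hC s h1 h2 h3 => ⟨s, h1, h2, ?_⟩⟩
      simpa using h3
    · rintro S T hST ⟨K, h1, h2⟩
      exact ⟨K, hST.trans h1, h2⟩
    · rintro S T ⟨K, h1, h2, h3⟩ ⟨K', h1', h2', h3'⟩
      refine ⟨K ∪ K', union_subset_union h1 h1', h2.union h2', fun C hC s a1 a2 a3 => ?_⟩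
      obtain ⟨s', b1, b2, b3⟩ := h3 C hC s a1 a2 a3
      obtain ⟨s'', c1, c2, c3⟩ := h3' _ (hC.union h2) s' b1 b2 b3
      exact ⟨s'', c1, c2, by rwa [← union_assoc]⟩
    · intro x₀ _
      obtain ⟨K, hK, hKc, hp⟩ := exists_perturbation (F := F) (ι := ι) hF₀ x₀
      refine ⟨K, mem_nhdsWithin_of_mem_nhds hK, K, subset_rfl, hKc, fun C hC s h1 h2 h3 => ?_⟩
      obtain ⟨p, hp1, hp2⟩ := hp s h1
      have hcont : ∀ i, Continuous fun z : 𝕜 × X =>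
          TotalSpace.mk' F₀ z.2 (s i z.2 + z.1 • p i z.2) := fun i =>
        continuous_section_add 𝕜 ((h1 i).comp continuous_snd)
          (continuous_section_smul continuous_fst ((hp1 i).comp continuous_snd))
      have hz : ∀ i x, s i x + (0 : 𝕜) • p i x = s i x := fun i x => by rw [zero_smul, add_zero]
      -- Openness in `(c, x)` jointly, together with compactness, gives one bound on `c` valid for
      -- all `x`; the same argument applies on `C` below.
      have ev1 : ∀ᶠ c in 𝓝 (0 : 𝕜), ∀ x ∈ (univ : Set X),
          (L x).range ⊔ Submodule.span 𝕜 (range fun i => s i x + c • p i x) = ⊤ := by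
        refine isCompact_univ.eventually_forall_of_forall_eventually fun x _ => ?_
        refine eventually_sup_span_eq_top hL hker (b := fun z : 𝕜 × X => z.2)
          (t := fun i z => s i z.2 + z.1 • p i z.2) hcont continuous_snd ?_
        simpa only [hz] using h2 x
      have ev2 : ∀ᶠ c in 𝓝 (0 : 𝕜), ∀ x ∈ C,
          LinearIndependent 𝕜 fun i => s i x + c • p i x := by
        refine hC.isCompact.eventually_forall_of_forall_eventually fun x hx => ?_
        refine eventually_linearIndependent (b := fun z : 𝕜 × X => z.2)
          (t := fun i z => s i z.2 + z.1 • p i z.2) hcont continuous_snd ?_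
        simpa only [hz] using h3 x hx
      have ev3 : ∀ᶠ c in 𝓝[≠] (0 : 𝕜), c ≠ 0 := self_mem_nhdsWithin
      obtain ⟨c, ⟨c1, c2⟩, c3⟩ := (((ev1.and ev2).filter_mono nhdsWithin_le_nhds).and ev3).exists
      refine ⟨fun i x => s i x + c • p i x, fun i => ?_, fun x => c1 x (mem_univ x), ?_⟩
      · exact continuous_section_add 𝕜 (b := fun x => x) (h1 i)
          (continuous_section_smul (b := fun x => x) continuous_const (hp1 i))
      · rintro x (hx | hx)
        · exact c2 x hx
        · exact hp2 x hx c c3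
  obtain ⟨K, h1, h2, h3⟩ := key
  obtain ⟨s, a1, a2, a3⟩ := h3 ∅ isClosed_empty s₀ hs₀ hs₀' fun x hx => hx.elim
  exact ⟨s, a1, a2, fun x => a3 x (Or.inr (h1 (mem_univ x)))⟩

theorem exists_isTransversal [CompactSpace X] [T2Space X] [CompleteSpace E₀]
    [CompleteSpace F₀] {L : ∀ x, E x →L[𝕜] F x} (hL : IsMorphism E₀ F₀ L)
    (hker : ∀ x, FiniteDimensional 𝕜 (L x).ker) (hcoker : ∀ x, (L x).range.CoFG) :
    ∃ V : FiniteDimSubbundle 𝕜 F₀ F, IsTransversal F₀ L V := by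
  by_cases hF₀ : FiniteDimensional 𝕜 F₀
  · exact ⟨⟨_, isFiniteDimBundle_top⟩, fun x => sup_top_eq _⟩
  · obtain ⟨ι, _, s₀, h1, h2⟩ := exists_sections_sup_span_eq_top hL hker hcoker
    obtain ⟨s, h3, h4, h5⟩ := exists_linearIndependent_sections hL hker hF₀ h1
      fun x => h2 x (mem_univ x)
    exact ⟨⟨_, isFiniteDimBundle_span h3 h5⟩, h4⟩

end Existence

/-! ### Direct sums -/

section ProdAlgebra

variable {R M N : Type*} [Ring R] [AddCommGroup M] [Module R M] [AddCommGroup N] [Module R N]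

/-- A product of submodules, as a module, is the product of the submodules. -/
def submoduleProdEquiv (p : Submodule R M) (q : Submodule R N) : p.prod q ≃ₗ[R] p × q where
  toFun z := (⟨z.1.1, z.2.1⟩, ⟨z.1.2, z.2.2⟩)
  invFun z := ⟨(z.1, z.2), z.1.2, z.2.2⟩
  map_add' _ _ := rfl
  map_smul' _ _ := rfl
  left_inv _ := rfl
  right_inv _ := rfl

/-- The quotient by a product of submodules is the product of the quotients. -/
def quotientProdEquiv (p : Submodule R M) (q : Submodule R N) :
    ((M × N) ⧸ p.prod q) ≃ₗ[R] (M ⧸ p) × (N ⧸ q) :=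
  (Submodule.quotEquivOfEq _ _ (by rw [LinearMap.ker_prodMap, Submodule.ker_mkQ,
    Submodule.ker_mkQ])).trans
    ((p.mkQ.prodMap q.mkQ).quotKerEquivOfSurjective
      (p.mkQ_surjective.prodMap q.mkQ_surjective))

end ProdAlgebra

/-! ### Direct sums of Fredholm operators. -/

section ProdFredholm

variable {𝕜 : Type*} [RCLike 𝕜] {M N M' N' : Type*}
  [AddCommGroup M] [Module 𝕜 M] [TopologicalSpace M]
  [AddCommGroup N] [Module 𝕜 N] [TopologicalSpace N]
  [AddCommGroup M'] [Module 𝕜 M'] [TopologicalSpace M']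
  [AddCommGroup N'] [Module 𝕜 N'] [TopologicalSpace N']

theorem fredholmIndex_prodMap {S : M →L[𝕜] N} {T : M' →L[𝕜] N'} (hS : S.IsFredholm)
    (hT : T.IsFredholm) :
    fredholmIndex (S.prodMap T) = fredholmIndex S + fredholmIndex T := by
  have : FiniteDimensional 𝕜 S.ker := hS.finite_ker
  have : FiniteDimensional 𝕜 T.ker := hT.finite_ker
  have : Module.Finite 𝕜 (N ⧸ S.range) := hS.finite_coker
  have : Module.Finite 𝕜 (N' ⧸ T.range) := hT.finite_coker
  have h1 : (S.prodMap T).ker = S.ker.prod T.ker := LinearMap.ker_prodMap _ _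
  have h2 : (S.prodMap T).range = S.range.prod T.range := LinearMap.range_prodMap _ _
  rw [fredholmIndex, h1, h2, (submoduleProdEquiv _ _).finrank_eq,
    (quotientProdEquiv _ _).finrank_eq, Module.finrank_prod, Module.finrank_prod, fredholmIndex,
    fredholmIndex]
  push_cast
  ring

open LinearMap.FiniteRangeSetoid in
theorem prodMap_equiv_id {P Q : Type*} [AddCommGroup P] [Module 𝕜 P] [AddCommGroup Q]
    [Module 𝕜 Q] {a : P →ₗ[𝕜] P} {b : Q →ₗ[𝕜] Q} (ha : a ≈ .id) (hb : b ≈ .id) :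
    a.prodMap b ≈ .id := by
  rw [LinearMap.FiniteRangeSetoid.equiv_iff_hasFiniteRange,
    LinearMap.hasFiniteRange_iff_range] at *
  have : a.prodMap b - .id = (a - .id).prodMap (b - .id) := by ext <;> simp
  rw [this, LinearMap.range_prodMap]
  exact ha.prod hb

/-- The sum of two inverses modulo finite rank operators is an inverse modulo finite rank operators.
-/
theorem isFredholm_prodMap [IsTopologicalAddGroup M] [ContinuousSMul 𝕜 M] [T2Space M]
    [IsTopologicalAddGroup N] [ContinuousSMul 𝕜 N] [T2Space N]
    [IsTopologicalAddGroup M'] [ContinuousSMul 𝕜 M'] [T2Space M']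
    [IsTopologicalAddGroup N'] [ContinuousSMul 𝕜 N'] [T2Space N']
    {S : M →L[𝕜] N} {T : M' →L[𝕜] N'} (hS : S.IsFredholm) (hT : T.IsFredholm) :
    (S.prodMap T).IsFredholm := by
  obtain ⟨S', hS₁, hS₂⟩ := hS.exists_isQuasiInverse
  obtain ⟨T', hT₁, hT₂⟩ := hT.exists_isQuasiInverse
  exact ContinuousLinearMap.IsFredholm.of_isQuasiInverse (v := S'.prodMap T')
    ⟨prodMap_equiv_id hS₁ hT₁, prodMap_equiv_id hS₂ hT₂⟩

end ProdFredholm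

section

variable {𝕜 : Type*} [RCLike 𝕜] {X : Type u} [TopologicalSpace X]
  {E₀ : Type*} {E : X → Type v} [∀ x, AddCommGroup (E x)] [∀ x, Module 𝕜 (E x)]
  [TopologicalSpace (TotalSpace E₀ E)]
  {E₀' : Type*} {E' : X → Type v} [∀ x, AddCommGroup (E' x)] [∀ x, Module 𝕜 (E' x)]
  [TopologicalSpace (TotalSpace E₀' E')]

theorem FiniteDimSubbundle.isInducing_prod (V : FiniteDimSubbundle 𝕜 E₀ E)
    (V' : FiniteDimSubbundle 𝕜 E₀' E') (Z : ∀ x, Submodule 𝕜 (E x × E' x))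
    (φ : ∀ x, Z x ≃ₗ[𝕜] V.space x × V'.space x)
    (hφ : ∀ x (z : Z x), (((φ x z).1 : E x), ((φ x z).2 : E' x)) = z) :
    letI := subspaceTopology 𝕜 (E₀ × E₀') (E ×ᵇ E') Z
    IsInducing fun p : TotalSpace Unit fun x => Z x =>
      ((⟨p.1, (φ p.1 p.2).1⟩, ⟨p.1, (φ p.1 p.2).2⟩) :
        TotalSpace Unit V.toBundle.Fiber × TotalSpace Unit V'.toBundle.Fiber) := by
  let := subspaceTopology 𝕜 (E₀ × E₀') (E ×ᵇ E') Z
  rw [← (V.isInducing_subtype.prodMap V'.isInducing_subtype).of_comp_iff]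
  have h : IsInducing fun p : TotalSpace Unit fun x => Z x =>
    (⟨p.1, (p.2 : E p.1 × E' p.1)⟩ : TotalSpace (E₀ × E₀') (E ×ᵇ E')) := ⟨rfl⟩
  convert (FiberBundle.Prod.isInducing_diag E₀ E E₀' E').comp h using 1
  funext p
  refine Prod.ext ?_ ?_
  · exact congrArg (TotalSpace.mk' E₀ p.1) (congrArg Prod.fst (hφ p.1 p.2))
  · exact congrArg (TotalSpace.mk' E₀' p.1) (congrArg Prod.snd (hφ p.1 p.2))

/-- The fibrewise product of two subbundles. -/
def FiniteDimSubbundle.prod (V : FiniteDimSubbundle 𝕜 E₀ E) (V' : FiniteDimSubbundle 𝕜 E₀' E') :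
    FiniteDimSubbundle 𝕜 (E₀ × E₀') (E ×ᵇ E') where
  space x := (V.space x).prod (V'.space x)
  isFiniteDimBundle :=
    letI := subspaceTopology 𝕜 (E₀ × E₀') (E ×ᵇ E') fun x => (V.space x).prod (V'.space x)
    isFiniteDimBundle_of_isInducing V.toBundle.isFiniteDimBundle V'.toBundle.isFiniteDimBundle
      (fun x => submoduleProdEquiv (V.space x) (V'.space x))
      (V.isInducing_prod V' _ (fun x => submoduleProdEquiv (V.space x) (V'.space x))
        fun _ _ => rfl)

theorem FiniteDimSubbundle.toK_eq_add_of_space_eq_prod (V : FiniteDimSubbundle 𝕜 E₀ E)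
    (V' : FiniteDimSubbundle 𝕜 E₀' E') (Z : FiniteDimSubbundle 𝕜 (E₀ × E₀') (E ×ᵇ E'))
    (hZ : ∀ x, Z.space x = (V.space x).prod (V'.space x)) :
    Z.toBundle.toK = V.toBundle.toK + V'.toBundle.toK := by
  let φ : ∀ x, Z.space x ≃ₗ[𝕜] V.space x × V'.space x := fun x =>
    (LinearEquiv.ofEq _ _ (hZ x)).trans (submoduleProdEquiv (V.space x) (V'.space x))
  exact FiniteDimBundle.toK_eq_add ⟨φ, V.isInducing_prod V' Z.space φ fun _ _ => rfl⟩

end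

/-! ### Products of local trivializations. -/

section ProdBundle

variable {𝕜 : Type*} [RCLike 𝕜] {X : Type u} [TopologicalSpace X]
  {E₀ : Type*} [NormedAddCommGroup E₀] [NormedSpace 𝕜 E₀]
  {E : X → Type v} [∀ x, AddCommGroup (E x)] [∀ x, Module 𝕜 (E x)] [∀ x, TopologicalSpace (E x)]
  [TopologicalSpace (TotalSpace E₀ E)] [FiberBundle E₀ E]
  {E₀' : Type*} [NormedAddCommGroup E₀'] [NormedSpace 𝕜 E₀']
  {E' : X → Type v} [∀ x, AddCommGroup (E' x)] [∀ x, Module 𝕜 (E' x)]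
  [∀ x, TopologicalSpace (E' x)]
  [TopologicalSpace (TotalSpace E₀' E')] [FiberBundle E₀' E']

theorem continuousLinearMapAt_prod (e : Trivialization E₀ (π E₀ E)) [e.IsLinear 𝕜]
    [MemTrivializationAtlas e] (e' : Trivialization E₀' (π E₀' E')) [e'.IsLinear 𝕜]
    [MemTrivializationAtlas e'] {x : X} (hx : x ∈ e.baseSet) (hx' : x ∈ e'.baseSet)
    (w : E x × E' x) :
    (e.prod e').continuousLinearMapAt 𝕜 x w =
      (e.continuousLinearMapAt 𝕜 x w.1, e'.continuousLinearMapAt 𝕜 x w.2) := by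
  rw [e.continuousLinearMapAt_apply_of_mem 𝕜 hx, e'.continuousLinearMapAt_apply_of_mem 𝕜 hx']
  exact (e.prod e').continuousLinearMapAt_apply_of_mem 𝕜 ⟨hx, hx'⟩ w

theorem symmL_prod (e : Trivialization E₀ (π E₀ E)) [e.IsLinear 𝕜]
    [MemTrivializationAtlas e] (e' : Trivialization E₀' (π E₀' E')) [e'.IsLinear 𝕜]
    [MemTrivializationAtlas e'] {x : X} (hx : x ∈ e.baseSet) (hx' : x ∈ e'.baseSet)
    (z : E₀ × E₀') :
    (e.prod e').symmL 𝕜 x z = (e.symmL 𝕜 x z.1, e'.symmL 𝕜 x z.2) := by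
  have h1 := continuousLinearMapAt_prod (𝕜 := 𝕜) e e' hx hx' (e.symmL 𝕜 x z.1, e'.symmL 𝕜 x z.2)
  rw [e.continuousLinearMapAt_symmL hx, e'.continuousLinearMapAt_symmL hx'] at h1
  have h2 := (e.prod e').symmL_continuousLinearMapAt (R := 𝕜) (b := x) ⟨hx, hx'⟩
    (e.symmL 𝕜 x z.1, e'.symmL 𝕜 x z.2)
  rw [← h2]
  exact congrArg _ h1.symm

end ProdBundle

section

variable {𝕜 : Type*} [RCLike 𝕜] {X : Type u} [TopologicalSpace X]
  {E₀ : Type*} {E : X → Type v} [∀ x, AddCommGroup (E x)] [∀ x, Module 𝕜 (E x)]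
  [TopologicalSpace (TotalSpace E₀ E)]
  [∀ x, TopologicalSpace (E x)]
  {F₀ : Type*} {F : X → Type v} [∀ x, AddCommGroup (F x)] [∀ x, Module 𝕜 (F x)]
  [∀ x, TopologicalSpace (F x)] [TopologicalSpace (TotalSpace F₀ F)]

theorem isIndexBundle_ind_of_exists {L : ∀ x, E x →L[𝕜] F x}
    (h : ∃ κ, IsIndexBundle E₀ F₀ L κ) : IsIndexBundle E₀ F₀ L (ind E₀ F₀ L) := by
  rw [ind, dif_pos h]
  exact h.choose_spec

variable {E₀' : Type*} {E' : X → Type v} [∀ x, AddCommGroup (E' x)] [∀ x, Module 𝕜 (E' x)]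
  [TopologicalSpace (TotalSpace E₀' E')] [∀ x, TopologicalSpace (E' x)]
  {F₀' : Type*} {F' : X → Type v} [∀ x, AddCommGroup (F' x)] [∀ x, Module 𝕜 (F' x)]
  [∀ x, TopologicalSpace (F' x)] [TopologicalSpace (TotalSpace F₀' F')]

theorem IsTransversal.prod {L : ∀ x, E x →L[𝕜] F x} {M : ∀ x, E' x →L[𝕜] F' x}
    {V : FiniteDimSubbundle 𝕜 F₀ F} {V' : FiniteDimSubbundle 𝕜 F₀' F'}
    (hV : IsTransversal F₀ L V) (hV' : IsTransversal F₀' M V') :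
    IsTransversal (F₀ × F₀') (E := E ×ᵇ E') (F := F ×ᵇ F') (fun x => (L x).prodMap (M x))
      (V.prod V') := by
  intro x
  have h1 : ((L x).prodMap (M x)).range = (L x).range.prod (M x).range :=
    LinearMap.range_prodMap _ _
  have h2 : ((L x).range.prod (M x).range) ⊔ ((V.space x).prod (V'.space x)) = ⊤ := by
    rw [Submodule.prod_sup_prod, hV x, hV' x, Submodule.prod_top]
  rw [← h1] at h2
  exact h2

/-- Each index class may be evaluated on any transversal subbundle, so `V`, `V'` and `V ⊕ V'` are
used; the preimage of a product under `L ⊕ M` is the product of the preimages. -/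
theorem IsIndexBundle.add {L : ∀ x, E x →L[𝕜] F x} {M : ∀ x, E' x →L[𝕜] F' x}
    {κ₁ κ₂ κ : KGroup.{u, v} 𝕜 X} (h₁ : IsIndexBundle E₀ F₀ L κ₁)
    (h₂ : IsIndexBundle E₀' F₀' M κ₂)
    (h : IsIndexBundle (E₀ × E₀') (F₀ × F₀') (E := E ×ᵇ E') (F := F ×ᵇ F')
      (fun x => (L x).prodMap (M x)) κ) : κ = κ₁ + κ₂ := by
  obtain ⟨⟨V, hV⟩, h₁⟩ := h₁
  obtain ⟨⟨V', hV'⟩, h₂⟩ := h₂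
  obtain ⟨W, hW, rfl⟩ := h₁ V hV
  obtain ⟨W', hW', rfl⟩ := h₂ V' hV'
  obtain ⟨Z, hZ, rfl⟩ := h.2 (V.prod V') (hV.prod hV')
  rw [FiniteDimSubbundle.toK_eq_add_of_space_eq_prod V V' (V.prod V') fun x => rfl,
    FiniteDimSubbundle.toK_eq_add_of_space_eq_prod W W' Z fun x => ?_]
  · abel
  · rw [hZ x, hW x, hW' x]
    rfl

end

theorem continuousAt_prodMap {𝕜 : Type*} [RCLike 𝕜] {P Q P' Q' Y : Type*}
    [NormedAddCommGroup P] [NormedSpace 𝕜 P] [NormedAddCommGroup Q] [NormedSpace 𝕜 Q]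
    [NormedAddCommGroup P'] [NormedSpace 𝕜 P']
    [NormedAddCommGroup Q'] [NormedSpace 𝕜 Q'] [TopologicalSpace Y] {S : Y → P →L[𝕜] Q}
    {T : Y → P' →L[𝕜] Q'} {y : Y} (hS : ContinuousAt S y) (hT : ContinuousAt T y) :
    ContinuousAt (fun y => (S y).prodMap (T y)) y :=
  Tendsto.comp (ContinuousLinearMap.prodMapL 𝕜 P Q P' Q').continuous.continuousAt
      (hS.prodMk hT)

/-! ### Direct sums of Fredholm morphisms and well-definedness of the index bundle. -/

section IndexBundles

variable {𝕜 : Type*} [RCLike 𝕜] {X : Type u} [TopologicalSpace X]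
  {E₀ : Type*} [NormedAddCommGroup E₀] [NormedSpace 𝕜 E₀]
  {E : X → Type v} [∀ x, AddCommGroup (E x)] [∀ x, Module 𝕜 (E x)] [∀ x, TopologicalSpace (E x)]
  [TopologicalSpace (TotalSpace E₀ E)] [FiberBundle E₀ E] [VectorBundle 𝕜 E₀ E]
  {F₀ : Type*} [NormedAddCommGroup F₀] [NormedSpace 𝕜 F₀]
  {F : X → Type v} [∀ x, AddCommGroup (F x)] [∀ x, Module 𝕜 (F x)] [∀ x, TopologicalSpace (F x)]
  [TopologicalSpace (TotalSpace F₀ F)] [FiberBundle F₀ F] [VectorBundle 𝕜 F₀ F]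
  {E₀' : Type*} [NormedAddCommGroup E₀'] [NormedSpace 𝕜 E₀']
  {E' : X → Type v} [∀ x, AddCommGroup (E' x)] [∀ x, Module 𝕜 (E' x)]
  [∀ x, TopologicalSpace (E' x)]
  [TopologicalSpace (TotalSpace E₀' E')] [FiberBundle E₀' E'] [VectorBundle 𝕜 E₀' E']
  {F₀' : Type*} [NormedAddCommGroup F₀'] [NormedSpace 𝕜 F₀']
  {F' : X → Type v} [∀ x, AddCommGroup (F' x)] [∀ x, Module 𝕜 (F' x)]
  [∀ x, TopologicalSpace (F' x)]
  [TopologicalSpace (TotalSpace F₀' F')] [FiberBundle F₀' F'] [VectorBundle 𝕜 F₀' F']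

theorem localRep_prodMap (e : Trivialization E₀ (π E₀ E)) [MemTrivializationAtlas e]
    (e' : Trivialization E₀' (π E₀' E')) [MemTrivializationAtlas e']
    (f : Trivialization F₀ (π F₀ F)) [MemTrivializationAtlas f]
    (f' : Trivialization F₀' (π F₀' F')) [MemTrivializationAtlas f']
    (L : ∀ x, E x →L[𝕜] F x) (M : ∀ x, E' x →L[𝕜] F' x) {x : X}
    (hx : x ∈ e.baseSet) (hx' : x ∈ e'.baseSet) (hy : x ∈ f.baseSet) (hy' : x ∈ f'.baseSet) :
    localRep (E := E ×ᵇ E') (F := F ×ᵇ F') (e.prod e') (f.prod f')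
      (fun x => (L x).prodMap (M x)) x =
      (localRep e f L x).prodMap (localRep e' f' M x) := by
  refine ContinuousLinearMap.ext fun z => ?_
  simp only [localRep]
  rw [ContinuousLinearMap.comp_apply, ContinuousLinearMap.comp_apply, symmL_prod e e' hx hx']
  exact continuousLinearMapAt_prod f f' hy hy' _

variable [∀ x, IsTopologicalAddGroup (F x)] [∀ x, ContinuousSMul 𝕜 (F x)]

theorem isMorphism_of_continuousAt_localRep {L : ∀ x, E x →L[𝕜] F x}
    (h : ∀ x, ∃ (e : Trivialization E₀ (π E₀ E)) (_ : MemTrivializationAtlas e)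
      (f : Trivialization F₀ (π F₀ F)) (_ : MemTrivializationAtlas f),
      x ∈ e.baseSet ∧ x ∈ f.baseSet ∧ ContinuousAt (localRep e f L) x) : IsMorphism E₀ F₀ L := by
  refine continuous_iff_continuousAt.2 fun x => ?_
  obtain ⟨e, _, f, _, he, hf, h⟩ := h x
  rw [continuousAt_hom_section_iff 𝕜 (b := fun x => x) e f he hf]
  exact ⟨continuousAt_id, h⟩

variable [∀ x, IsTopologicalAddGroup (F' x)] [∀ x, ContinuousSMul 𝕜 (F' x)]

theorem IsMorphism.continuousAt_localRep_prodMap {L : ∀ x, E x →L[𝕜] F x}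
    (hL : IsMorphism E₀ F₀ L) {M : ∀ x, E' x →L[𝕜] F' x} (hM : IsMorphism E₀' F₀' M)
    (e : Trivialization E₀ (π E₀ E)) [MemTrivializationAtlas e]
    (e' : Trivialization E₀' (π E₀' E')) [MemTrivializationAtlas e']
    (f : Trivialization F₀ (π F₀ F)) [MemTrivializationAtlas f]
    (f' : Trivialization F₀' (π F₀' F')) [MemTrivializationAtlas f'] {x : X}
    (he : x ∈ e.baseSet) (he' : x ∈ e'.baseSet) (hf : x ∈ f.baseSet) (hf' : x ∈ f'.baseSet) :
    ContinuousAt (localRep (E := E ×ᵇ E') (F := F ×ᵇ F') (e.prod e') (f.prod f')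
      (fun x => (L x).prodMap (M x))) x := by
  refine (continuousAt_prodMap (hL.continuousAt_localRep e f he hf)
    (hM.continuousAt_localRep e' f' he' hf')).congr ?_
  filter_upwards [e.open_baseSet.mem_nhds he, e'.open_baseSet.mem_nhds he',
    f.open_baseSet.mem_nhds hf, f'.open_baseSet.mem_nhds hf'] with x hx hx' hy hy'
  exact (localRep_prodMap e e' f f' L M hx hx' hy hy').symm

/-- In product trivializations `L ⊕ M` is block diagonal, and forming block diagonal operators is
norm continuous. -/
theorem IsMorphism.prodMap {L : ∀ x, E x →L[𝕜] F x} (hL : IsMorphism E₀ F₀ L)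
    {M : ∀ x, E' x →L[𝕜] F' x} (hM : IsMorphism E₀' F₀' M) :
    IsMorphism (E₀ × E₀') (F₀ × F₀') (E := E ×ᵇ E') (F := F ×ᵇ F')
      fun x => (L x).prodMap (M x) := by
  refine isMorphism_of_continuousAt_localRep (E := E ×ᵇ E') (F := F ×ᵇ F') fun x => ?_
  have he := mem_baseSet_trivializationAt E₀ E x
  have he' := mem_baseSet_trivializationAt E₀' E' x
  have hf := mem_baseSet_trivializationAt F₀ F x
  have hf' := mem_baseSet_trivializationAt F₀' F' x
  exact ⟨(trivializationAt E₀ E x).prod (trivializationAt E₀' E' x), inferInstance,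
    (trivializationAt F₀ F x).prod (trivializationAt F₀' F' x), inferInstance,
    ⟨he, he'⟩, ⟨hf, hf'⟩, hL.continuousAt_localRep_prodMap hM _ _ _ _ he he' hf hf'⟩

variable [∀ x, IsTopologicalAddGroup (E x)] [∀ x, ContinuousSMul 𝕜 (E x)]

theorem IsFredholmMorphism.isIndexBundle_ind [CompactSpace X] [T2Space X] [CompleteSpace E₀]
    [CompleteSpace F₀] {L : ∀ x, E x →L[𝕜] F x} (hL : IsFredholmMorphism E₀ F₀ L) :
    IsIndexBundle E₀ F₀ L (ind E₀ F₀ L) := by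
  obtain ⟨hL, k, hk⟩ := hL
  have hker : ∀ x, FiniteDimensional 𝕜 (L x).ker := fun x => (hk x).1.finite_ker
  obtain ⟨V, hV⟩ := exists_isTransversal hL hker fun x => (hk x).1.finite_coker
  obtain ⟨W, hW⟩ := exists_finiteDimSubbundle_comap hL hker hV
  refine isIndexBundle_ind_of_exists ⟨W.toBundle.toK - V.toBundle.toK, ⟨V, hV⟩, fun V' hV' => ?_⟩
  obtain ⟨W', hW'⟩ := exists_finiteDimSubbundle_comap hL hker hV'
  exact ⟨W', hW', toK_sub_toK_eq hL hker hV hV' hW hW'⟩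

variable [∀ x, IsTopologicalAddGroup (E' x)] [∀ x, ContinuousSMul 𝕜 (E' x)]

theorem IsFredholmMorphism.prodMap {L : ∀ x, E x →L[𝕜] F x} (hL : IsFredholmMorphism E₀ F₀ L)
    {M : ∀ x, E' x →L[𝕜] F' x} (hM : IsFredholmMorphism E₀' F₀' M) :
    IsFredholmMorphism (E₀ × E₀') (F₀ × F₀') (E := E ×ᵇ E') (F := F ×ᵇ F')
      fun x => (L x).prodMap (M x) := by
  obtain ⟨hL, k, hk⟩ := hL
  obtain ⟨hM, l, hl⟩ := hM
  refine ⟨hL.prodMap hM, k + l, fun x => ⟨?_, ?_⟩⟩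
  · have := FiberBundle.t2Space E₀ E x
    have := FiberBundle.t2Space F₀ F x
    have := FiberBundle.t2Space E₀' E' x
    have := FiberBundle.t2Space F₀' F' x
    exact isFredholm_prodMap (hk x).1 (hl x).1
  · rw [← (hk x).2, ← (hl x).2]
    exact fredholmIndex_prodMap (hk x).1 (hl x).1

end IndexBundles

end IndexBundle

end

theorem mainTheorem9 {𝕜 : Type*} [RCLike 𝕜]
    {X : Type u} [TopologicalSpace X] [CompactSpace X] [T2Space X]
    -- the Banach bundle `E` with model space `E₀`
    {E₀ : Type*} [NormedAddCommGroup E₀] [NormedSpace 𝕜 E₀] [CompleteSpace E₀]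
    {E : X → Type v} [∀ x, AddCommGroup (E x)] [∀ x, Module 𝕜 (E x)] [∀ x, TopologicalSpace (E x)]
    [∀ x, IsTopologicalAddGroup (E x)] [∀ x, ContinuousSMul 𝕜 (E x)]
    [TopologicalSpace (TotalSpace E₀ E)] [FiberBundle E₀ E] [VectorBundle 𝕜 E₀ E]
    -- the Banach bundle `F` with model space `F₀`
    {F₀ : Type*} [NormedAddCommGroup F₀] [NormedSpace 𝕜 F₀] [CompleteSpace F₀]
    {F : X → Type v} [∀ x, AddCommGroup (F x)] [∀ x, Module 𝕜 (F x)] [∀ x, TopologicalSpace (F x)]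
    [∀ x, IsTopologicalAddGroup (F x)] [∀ x, ContinuousSMul 𝕜 (F x)]
    [TopologicalSpace (TotalSpace F₀ F)] [FiberBundle F₀ F] [VectorBundle 𝕜 F₀ F]
    -- the Banach bundle `E'` with model space `E₀'`
    {E₀' : Type*} [NormedAddCommGroup E₀'] [NormedSpace 𝕜 E₀'] [CompleteSpace E₀']
    {E' : X → Type v} [∀ x, AddCommGroup (E' x)] [∀ x, Module 𝕜 (E' x)]
    [∀ x, TopologicalSpace (E' x)] [∀ x, IsTopologicalAddGroup (E' x)]
    [∀ x, ContinuousSMul 𝕜 (E' x)]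
    [TopologicalSpace (TotalSpace E₀' E')] [FiberBundle E₀' E'] [VectorBundle 𝕜 E₀' E']
    -- the Banach bundle `F'` with model space `F₀'`
    {F₀' : Type*} [NormedAddCommGroup F₀'] [NormedSpace 𝕜 F₀'] [CompleteSpace F₀']
    {F' : X → Type v} [∀ x, AddCommGroup (F' x)] [∀ x, Module 𝕜 (F' x)]
    [∀ x, TopologicalSpace (F' x)] [∀ x, IsTopologicalAddGroup (F' x)]
    [∀ x, ContinuousSMul 𝕜 (F' x)]
    [TopologicalSpace (TotalSpace F₀' F')] [FiberBundle F₀' F'] [VectorBundle 𝕜 F₀' F']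
    -- the Fredholm morphisms
    (L : ∀ x, E x →L[𝕜] F x) (hL : IsFredholmMorphism E₀ F₀ L)
    (M : ∀ x, E' x →L[𝕜] F' x) (hM : IsFredholmMorphism E₀' F₀' M) :
    -- `L ⊕ M : E ⊕ E' → F ⊕ F'` is a Fredholm morphism
    IsFredholmMorphism (E₀ × E₀') (F₀ × F₀') (E := E ×ᵇ E') (F := F ×ᵇ F')
        (fun x => (L x).prodMap (M x)) ∧
      -- the index bundles of `L`, `M` and `L ⊕ M` are well defined
      IsIndexBundle E₀ F₀ L (ind E₀ F₀ L) ∧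
      IsIndexBundle E₀' F₀' M (ind E₀' F₀' M) ∧
      IsIndexBundle (E₀ × E₀') (F₀ × F₀') (E := E ×ᵇ E') (F := F ×ᵇ F')
        (fun x => (L x).prodMap (M x))
        (ind (E₀ × E₀') (F₀ × F₀') (E := E ×ᵇ E') (F := F ×ᵇ F')
          (fun x => (L x).prodMap (M x))) ∧
      -- `ind (L ⊕ M) = ind L + ind M` in `K(X)`
      ind (E₀ × E₀') (F₀ × F₀') (E := E ×ᵇ E') (F := F ×ᵇ F') (fun x => (L x).prodMap (M x)) =
        ind E₀ F₀ L + ind E₀' F₀' M := by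
  have hLM := hL.prodMap hM
  have h1 := hL.isIndexBundle_ind
  have h2 := hM.isIndexBundle_ind
  have h3 := hLM.isIndexBundle_ind
  exact ⟨hLM, h1, h2, h3, h1.add h2 h3⟩
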